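/- **Model.** In the coordinator model there are $s$ servers, each with its own input, and a coordinator without input; all of them share a source of randomness. In the first round every server sends a message to the coordinator, computed from its own input and the shared randomness; the coordinator, seeing only these messages and the shared randomness, sends a (possibly different) answer to each server. In the second round every server sends a message computed from its input, that answer and the shared randomness, and the coordinator computes the output from all messages it received and the shared randomness. Messages are lists of words, and the communication is the total number of words in all messages, in both directions. In the problem below a word is either a string of $k\lceil\log_2 n\rceil$ bits (enough to name a tuple of $k$ indices in $[n]$), or one real number. Real numbers are atomic, so that they cannot be used to encode other data: server $j$ may send as a real number only one of the numbers $\sum_{v\in W_j}g(v_{i_1},\dots,v_{i_k})$ ($i_1,\dots,i_k\in[n]$ distinct) or a number it has received, and the coordinator may send only numbers it has received. **Definitions.** A function $f:\mathbb R_{\ge0}\to\mathbb R_{\ge0}$ is *approximately invertible* with parameters $\theta,\theta',\theta''>1$ if for all $x,y\ge0$: $f(x+y)\ge f(x)+f(y)$; $f(\theta'y)\ge\theta f(y)$; and $f\big(y/(4\sqrt\theta\,\theta')\big)\ge f(y)/\theta''$. For an integer $s\ge1$, $c_f[s]$ is the smallest $c\ge0$ such that $f(y_1+\dots+y_s)\le\frac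 cs\big(\sqrt{f(y_1)}+\dots+\sqrt{f(y_s)}\big)^2$ for all $y_1,\dots,y_s\ge0$. Given finite sets $W_1,\dots,W_s\subset\mathbb R_{\ge0}^n$ and $g:\mathbb R_{\ge0}^k\to\mathbb R_{\ge0}$, the correlation is $$M(f,g,W_1,\dots,W_s)=\sum_{i_1,\dots,i_k\in[n]\text{ distinct}}f\Big(\sum_{j=1}^s\sum_{v\in W_j}g(v_{i_1},\dots,v_{i_k})\Big).$$ **Theorem.** There is a universal constant $C>0$ such that the following holds for all integers $s,k\ge1$ and $n\ge2$, all $\varepsilon\in(0,1)$, every $f$ that is approximately invertible with parameters $\theta,\theta',\theta''>1$, and every $g:\mathbb R_{\ge0}^k\to\mathbb R_{\ge0}$. Put $A=\lceil C\log(s\theta'')/\log\theta\rceil$ and $B=\lceil C\log(s^2\theta''^2)/\log\theta\rceil$. There is a randomized two-round protocol (which may depend on $s,k,n,\varepsilon,f,g$ and the parameters) such that, whenever server $j$ holds a finite set $W_j$ of non-negative $n$-dimensional vectors, its output lies between $(1-\varepsilon)M(f,g,W_1,\dots,W_s)$ and $(1+\varepsilon)M(f,g,W_1,\dots,W_s)$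 with probability at least $9/10$, and its total communication is always at most $$C\left(\frac{c_f[s]}{\varepsilon^2}\cdot c_f[A\cdot B]\cdot(A\cdot B)\cdot\sqrt\theta\cdot\theta''^3\cdot k^4\log^4n+\frac{s}{\varepsilon^2}\cdot k^2\log^2n\cdot\theta''^4\right)$$ words. -/

import Mathlib

open MeasureTheory
open scoped NNReal

noncomputable section

/-- `f : ℝ≥0 → ℝ≥0` is approximately invertible with parameters `θ, θ', θ'' > 1`:
it is super-additive, `f (θ' y) ≥ θ f y` and `f (y / (4 √θ θ')) ≥ f y / θ''`. -/
structure ApproxInvertible (f : ℝ≥0 → ℝ≥0) (θ θ' θ'' : ℝ≥0) : Prop where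
  one_lt : 1 < θ
  one_lt' : 1 < θ'
  one_lt'' : 1 < θ''
  superadditive : ∀ x y, f x + f y ≤ f (x + y)
  growth : ∀ y, θ * f y ≤ f (θ' * y)
  shrink : ∀ y, f y / θ'' ≤ f (y / (4 * NNReal.sqrt θ * θ'))

/-- `c_f[s]`: the smallest number `c` such that
`f (y₁ + ⋯ + y_s) ≤ (c / s) (√(f y₁) + ⋯ + √(f y_s))²` for all `y₁, …, y_s ≥ 0`. -/
def cParam (f : ℝ≥0 → ℝ≥0) (s : ℕ) : ℝ≥0 :=
  sInf {c : ℝ≥0 | ∀ y : Fin s → ℝ≥0,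
    f (∑ j, y j) ≤ c / s * (∑ j, NNReal.sqrt (f (y j))) ^ 2}

/-- The coordinate at `(i₁, …, i_k)` (distinct indices) of the vector that a server holding the
finite set `W` of non-negative vectors aggregates: `∑_{v ∈ W} g (v_{i₁}, …, v_{i_k})`. -/
def aggregate {n k : ℕ} (g : (Fin k → ℝ≥0) → ℝ≥0) (W : Finset (Fin n → ℝ≥0))
    (i : Fin k ↪ Fin n) : ℝ≥0 :=
  ∑ v ∈ W, g (fun l => v (i l))

/-- The correlation
`M(f, g, W₁, …, W_s) = ∑_{i₁, …, i_k distinct} f (∑_j ∑_{v ∈ W_j} g (v_{i₁}, …, v_{i_k}))`. -/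
def correlation {n k s : ℕ} (f : ℝ≥0 → ℝ≥0) (g : (Fin k → ℝ≥0) → ℝ≥0)
    (W : Fin s → Finset (Fin n → ℝ≥0)) : ℝ≥0 :=
  ∑ i : Fin k ↪ Fin n, f (∑ j, aggregate g (W j) i)

/-- A word of communication: a string of `b` bits, or one non-negative real number. -/
inductive Word (b : ℕ) : Type
  | bits (c : Fin b → Bool) : Word b
  | value (x : ℝ≥0) : Word b

/-- A two-round protocol in the coordinator model with `s` servers, inputs in `I`, words of `b`
bits and shared randomness `ω : Ω`. First round: each server sends a message (a list of words)
that depends on its own input; the coordinator, seeing these messages only, answers each server.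
Second round: each server sends a message that depends on its input and on that answer; the
coordinator computes the output from the messages it has received.

The real numbers in `held a` are those which a server with input `a` holds. Real numbers are
atomic: a server may send only a number which it holds or has received, and the coordinator only
a number which it has received. (Otherwise a single real number could encode the whole input.) -/
structure TwoRoundProtocol (I : Type) (held : I → Set ℝ≥0) (s b : ℕ) (Ω : Type) where
  up₁ : Fin s → Ω → I → List (Word b)
  down : Fin s → Ω → (Fin s → List (Word b)) → List (Word b)
  up₂ : Fin s → Ω → I → List (Word b) → List (Word b)
  out : Ω → (Fin s → List (Word b)) → (Fin s → List (Word b)) → ℝ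
  up₁_atomic : ∀ j ω a x, Word.value x ∈ up₁ j ω a → x ∈ held a
  down_atomic : ∀ j ω m x, Word.value x ∈ down j ω m → ∃ j', Word.value x ∈ m j'
  up₂_atomic : ∀ j ω a d x, Word.value x ∈ up₂ j ω a d → x ∈ held a ∨ Word.value x ∈ d

namespace TwoRoundProtocol

variable {I : Type} {held : I → Set ℝ≥0} {s b : ℕ} {Ω : Type}

/-- The messages to the coordinator in the first round, on inputs `a` and randomness `ω`. -/
def msg₁ (p : TwoRoundProtocol I held s b Ω) (ω : Ω) (a : Fin s → I) : Fin s → List (Word b) :=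
  fun j => p.up₁ j ω (a j)

/-- The answers of the coordinator. -/
def answer (p : TwoRoundProtocol I held s b Ω) (ω : Ω) (a : Fin s → I) : Fin s → List (Word b) :=
  fun j => p.down j ω (p.msg₁ ω a)

/-- The messages to the coordinator in the second round. -/
def msg₂ (p : TwoRoundProtocol I held s b Ω) (ω : Ω) (a : Fin s → I) : Fin s → List (Word b) :=
  fun j => p.up₂ j ω (a j) (p.answer ω a j)

/-- The output of the coordinator. -/
def output (p : TwoRoundProtocol I held s b Ω) (ω : Ω) (a : Fin s → I) : ℝ :=
  p.out ω (p.msg₁ ω a) (p.msg₂ ω a)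

/-- The total communication, in words and in all directions. -/
def cost (p : TwoRoundProtocol I held s b Ω) (ω : Ω) (a : Fin s → I) : ℕ :=
  ∑ j, ((p.msg₁ ω a j).length + (p.answer ω a j).length + (p.msg₂ ω a j).length)

end TwoRoundProtocol

/-- `A = ⌈C log (s θ'') / log θ⌉`. -/
def bucketsA (C : ℝ) (s : ℕ) (θ θ'' : ℝ≥0) : ℕ :=
  ⌈C * Real.log (s * θ'') / Real.log θ⌉₊

/-- `B = ⌈C log (s² θ''²) / log θ⌉`. -/
def bucketsB (C : ℝ) (s : ℕ) (θ θ'' : ℝ≥0) : ℕ :=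
  ⌈C * Real.log (s ^ 2 * θ'' ^ 2) / Real.log θ⌉₊

end

/-! Write x_{j,i} for the aggregate of server j at the tuple i, a_i = f(∑_j x_{j,i}) and F = ∑_i
a_i. Shared randomness gives each tuple a weight 1/h_i, with h_i uniform in {1/M, …, 1} and M = n^k.
Keep i exactly when a_i/h_i ≥ τ and divide a_i by the probability of this event: for τ a small
multiple of ε²F this estimates F up to εF (`pr_est_le`). Since ∑ a_i/h_i is at most about F log M,
only about log M/ε² tuples are heavy. Once the coordinator has a short list containing them, it asks
for their exact values in the second round.

The first round finds them. Server j samples i, in T independent trials, with probability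
proportional to f(x_{j,i})/h_i. For a heavy tuple, drop the servers with tiny values and class the
others by the power of √θ below x_{j,i}. There are few classes, so c_f[AB] shows that one of them
accounts for a_i up to a bounded factor. If this class has r servers with values about y, then
c_f[s] bounds its contribution by (c_f[s]/s) r² θ'' f(y), which forces these servers to sample i
often enough in total (`exists_grp`). Thinned to a common rate, the sample counts certify the group
size r up to a constant, hence the lower bound f(yr/16)/h_i for a_i/h_i. As certified bounds are
true bounds, few tuples can have a large one, so the K best tuples include all heavy ones
(`subset_cand`).

The threshold is computed from the largest weighted value, which is random; rounding it to a power
of two leaves few possibilities, and a union bound applies (`pr_not_goodWeights_le`). The cost is of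
order s(T + K); since s ≤ c_f[s] for nonzero f, it fits into the first summand of the budget alone
(`cost_le_budget`). -/

noncomputable section

/-! ### Averages, independence and tail bounds on finite probability spaces. -/

namespace FiniteProb

open Finset
open scoped Classical

variable {Ω Ω' κ α : Type*} [Fintype Ω] [Fintype Ω'] [Fintype κ] [Fintype α]

/-- The average of a real function on a finite type. -/
def avg (X : Ω → ℝ) : ℝ := (∑ ω, X ω) / Fintype.card Ω

/-- The probability of a predicate under the uniform distribution on a finite type. -/
def pr (p : Ω → Prop) : ℝ := avg fun ω => if p ω then (1 : ℝ) else 0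

theorem avg_mono {X Y : Ω → ℝ} (h : ∀ ω, X ω ≤ Y ω) : avg X ≤ avg Y :=
  div_le_div_of_nonneg_right (sum_le_sum fun ω _ => h ω) (Nat.cast_nonneg _)

theorem avg_nonneg {X : Ω → ℝ} (h : ∀ ω, 0 ≤ X ω) : 0 ≤ avg X :=
  div_nonneg (sum_nonneg fun ω _ => h ω) (Nat.cast_nonneg _)

theorem avg_add (X Y : Ω → ℝ) : avg (fun ω => X ω + Y ω) = avg X + avg Y := by
  simp [avg, sum_add_distrib, add_div]

theorem avg_sub (X Y : Ω → ℝ) : avg (fun ω => X ω - Y ω) = avg X - avg Y := by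
  simp [avg, sum_sub_distrib, sub_div]

theorem avg_mul_left (c : ℝ) (X : Ω → ℝ) : avg (fun ω => c * X ω) = c * avg X := by
  simp [avg, ← mul_sum, mul_div_assoc]

theorem avg_sum {τ : Type*} (t : Finset τ) (X : τ → Ω → ℝ) :
    avg (fun ω => ∑ a ∈ t, X a ω) = ∑ a ∈ t, avg (X a) := by
  simp only [avg]
  rw [sum_comm, sum_div]

theorem avg_const [Nonempty Ω] (c : ℝ) : avg (fun _ : Ω => c) = c := by
  have : (Fintype.card Ω : ℝ) ≠ 0 := Nat.cast_ne_zero.2 Fintype.card_ne_zero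
  simp [avg, this]

theorem pr_le_one (p : Ω → Prop) : pr p ≤ 1 := by
  unfold pr avg
  refine div_le_one_of_le₀ ?_ (Nat.cast_nonneg _)
  calc _ ≤ ∑ _ω : Ω, (1 : ℝ) := sum_le_sum fun ω _ => by split_ifs <;> norm_num
    _ = _ := by simp

theorem pr_mono {p q : Ω → Prop} (h : ∀ ω, p ω → q ω) : pr p ≤ pr q :=
  avg_mono fun ω => by
    by_cases hp : p ω
    · simp [hp, h ω hp]
    · simp only [hp, if_false]; split_ifs <;> norm_num

theorem pr_false : pr (fun _ : Ω => False) = 0 := by simp [pr, avg]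

theorem pr_or_le (p q : Ω → Prop) : pr (fun ω => p ω ∨ q ω) ≤ pr p + pr q := by
  unfold pr
  rw [← avg_add]
  exact avg_mono fun ω => by by_cases hp : p ω <;> by_cases hq : q ω <;> simp [hp, hq]

theorem pr_exists_le {τ : Type*} (t : Finset τ) (p : τ → Ω → Prop) :
    pr (fun ω => ∃ a ∈ t, p a ω) ≤ ∑ a ∈ t, pr (p a) := by
  unfold pr
  rw [← avg_sum]
  refine avg_mono fun ω => ?_
  split_ifs with h
  · obtain ⟨a, ha, hp⟩ := h
    calc (1 : ℝ) = if p a ω then 1 else 0 := by simp [hp]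
      _ ≤ _ := single_le_sum (f := fun a => if p a ω then (1 : ℝ) else 0)
        (fun b _ => by split_ifs <;> norm_num) ha
  · exact sum_nonneg fun b _ => by split_ifs <;> norm_num

theorem pr_not [Nonempty Ω] (p : Ω → Prop) : pr (fun ω => ¬ p ω) = 1 - pr p := by
  unfold pr
  rw [eq_sub_iff_add_eq, ← avg_add]
  refine Eq.trans ?_ (avg_const (Ω := Ω) 1)
  congr 1
  funext ω
  by_cases h : p ω <;> simp [h]

/-- Markov's inequality. -/
theorem pr_le_avg_div {X : Ω → ℝ} (hX : ∀ ω, 0 ≤ X ω) {a : ℝ} (ha : 0 < a) :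
    pr (fun ω => a ≤ X ω) ≤ avg X / a := by
  rw [div_eq_inv_mul, ← avg_mul_left]
  refine avg_mono fun ω => ?_
  split_ifs with h
  · rw [← div_eq_inv_mul]; exact (one_le_div ha).2 h
  · exact mul_nonneg (inv_nonneg.2 ha.le) (hX ω)

theorem avg_prod_type (X : Ω × Ω' → ℝ) :
    avg X = avg fun ω => avg fun ω' => X (ω, ω') := by
  simp only [avg]
  rw [Fintype.sum_prod_type, ← sum_div, div_div, Fintype.card_prod]
  push_cast
  rw [mul_comm]

/-- If the first component is bad with probability at most `a`, and for each good first component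
the second one is bad with probability at most `b`, then some component is bad with probability at
most `a + b`. -/
theorem pr_prod_le [Nonempty Ω] (p : Ω → Prop) (q : Ω → Ω' → Prop) {a b : ℝ} (hb : 0 ≤ b)
    (hp : pr p ≤ a) (hq : ∀ ω, ¬ p ω → pr (q ω) ≤ b) :
    pr (fun ω : Ω × Ω' => p ω.1 ∨ q ω.1 ω.2) ≤ a + b := by
  have h1 : pr (fun ω : Ω × Ω' => p ω.1 ∨ q ω.1 ω.2)
      ≤ avg fun ω => (if p ω then (1 : ℝ) else 0) + b := by
    unfold pr
    rw [avg_prod_type]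
    refine avg_mono fun ω => ?_
    by_cases h : p ω
    · simp only [h, true_or, if_true]
      have := pr_le_one (Ω := Ω') (fun _ => True)
      simp only [pr, if_true] at this
      linarith
    · simpa [h, pr] using hq ω h
  rw [avg_add, avg_const] at h1
  unfold pr at hp
  linarith

variable [DecidableEq κ]

/-- Independence: the average of a product of functions of distinct coordinates. -/
theorem avg_prod (φ : κ → α → ℝ) :
    avg (fun m : κ → α => ∏ k, φ k (m k)) = ∏ k, avg (φ k) := by
  simp only [avg]
  rw [prod_div_distrib, ← Fintype.piFinset_univ, ← prod_univ_sum]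
  simp

theorem avg_coord [Nonempty α] (i : κ) (Y : α → ℝ) :
    avg (fun m : κ → α => Y (m i)) = avg Y := by
  have h := avg_prod (fun (k : κ) (a : α) => if k = i then Y a else 1)
  have h1 : ∀ k, avg (fun a : α => if k = i then Y a else 1) = if k = i then avg Y else 1 := by
    intro k
    split_ifs
    · rfl
    · exact avg_const 1
  simp only [h1] at h
  simpa using h

theorem avg_coord_mul [Nonempty α] {i j : κ} (hij : i ≠ j) (Y Z : α → ℝ) :
    avg (fun m : κ → α => Y (m i) * Z (m j)) = avg Y * avg Z := by
  have h := avg_prod (fun (k : κ) (a : α) =>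
    (if k = i then Y a else 1) * (if k = j then Z a else 1))
  have h1 : ∀ k, avg (fun a : α => (if k = i then Y a else 1) * (if k = j then Z a else 1))
      = (if k = i then avg Y else 1) * (if k = j then avg Z else 1) := by
    intro k
    by_cases hi : k = i
    · subst hi
      simp [hij]
    · by_cases hj : k = j
      · simp [hj]
        subst hj
        simp [hi]
      · simpa [hi, hj] using avg_const (Ω := α) 1
  simp only [h1, prod_mul_distrib] at h
  simpa using h

/-- Chebyshev's inequality for a sum of functions of distinct coordinates. -/
theorem pr_abs_sub_ge_le [Nonempty α] (Y : κ → α → ℝ) {t : ℝ} (ht : 0 < t) :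
    pr (fun m : κ → α => t ≤ |∑ k, Y k (m k) - ∑ k, avg (Y k)|)
      ≤ (∑ k, (avg (fun a => Y k a ^ 2) - avg (Y k) ^ 2)) / t ^ 2 := by
  set Z : κ → α → ℝ := fun k a => Y k a - avg (Y k) with hZ
  have hZ0 : ∀ k, avg (Z k) = 0 := fun k => by simp [hZ, avg_sub, avg_const]
  have hZ2 : ∀ k, avg (fun a => Z k a * Z k a) = avg (fun a => Y k a ^ 2) - avg (Y k) ^ 2 := by
    intro k
    have : (fun a => Z k a * Z k a)
        = fun a => Y k a ^ 2 - ((2 * avg (Y k)) * Y k a - avg (Y k) ^ 2) := by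
      funext a; simp only [hZ]; ring
    rw [this, avg_sub, avg_sub, avg_mul_left, avg_const]
    ring
  have hsum : avg (fun m : κ → α => (∑ k, Z k (m k)) ^ 2)
      = ∑ k, (avg (fun a => Y k a ^ 2) - avg (Y k) ^ 2) := by
    have : (fun m : κ → α => (∑ k, Z k (m k)) ^ 2)
        = fun m => ∑ i, ∑ j, Z i (m i) * Z j (m j) := by
      funext m; rw [sq, sum_mul_sum]
    rw [this, avg_sum]
    refine sum_congr rfl fun i _ => ?_
    rw [avg_sum, sum_eq_single i]
    · rw [avg_coord i (fun a => Z i a * Z i a)]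
      exact hZ2 i
    · intro j _ hj
      rw [avg_coord_mul hj.symm, hZ0, zero_mul]
    · simp
  calc _ ≤ pr (fun m : κ → α => t ^ 2 ≤ (∑ k, Z k (m k)) ^ 2) := by
        refine pr_mono fun m hm => ?_
        rw [hZ, sum_sub_distrib, ← sq_abs (_ - _)]
        gcongr
    _ ≤ _ := pr_le_avg_div (fun m => sq_nonneg _) (by positivity)
    _ = _ := by rw [hsum]

/-- The number of `k ∈ S` with `u k + 1 ≤ p k`. -/
def hits {M : ℕ} (S : Finset κ) (p : κ → ℝ) (u : κ → Fin M) : ℕ :=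
  #{k ∈ S | ((u k : ℕ) : ℝ) + 1 ≤ p k}

theorem avg_hit {M : ℕ} (p : ℝ) (hp : 0 ≤ p) :
    avg (fun a : Fin M => if ((a : ℕ) : ℝ) + 1 ≤ p then (1 : ℝ) else 0) = (min M ⌊p⌋₊ : ℕ) / M := by
  simp only [avg, Fintype.card_fin]
  congr 1
  rw [sum_boole]
  congr 1
  have : (univ.filter fun a : Fin M => ((a : ℕ) : ℝ) + 1 ≤ p)
      = univ.filter fun a : Fin M => (a : ℕ) < min M ⌊p⌋₊ := by
    ext a
    simp only [mem_filter, mem_univ, true_and, lt_min_iff, a.2]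
    rw [← Nat.add_one_le_iff, Nat.le_floor_iff hp]
    push_cast
    rfl
  rw [this, Fin.card_filter_val_lt]
  simp

theorem avg_hit_le {M : ℕ} (p : ℝ) (hp : 0 ≤ p) :
    avg (fun a : Fin M => if ((a : ℕ) : ℝ) + 1 ≤ p then (1 : ℝ) else 0) ≤ p / M := by
  rw [avg_hit p hp]
  gcongr
  exact (Nat.cast_le.2 (min_le_right _ _)).trans (Nat.floor_le hp)

/-- Rounding p down to an integer loses at most a factor of two once p ≥ 1. -/
theorem le_avg_hit {M : ℕ} {p : ℝ} (hp : 1 ≤ p) (hM : p ≤ M) :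
    p / (2 * M) ≤ avg (fun a : Fin M => if ((a : ℕ) : ℝ) + 1 ≤ p then (1 : ℝ) else 0) := by
  rw [avg_hit p (by linarith), min_eq_right (Nat.floor_le_of_le hM)]
  rw [← div_div]
  gcongr
  have h1 := Nat.lt_floor_add_one p
  have h2 : (1 : ℝ) ≤ ⌊p⌋₊ := by exact_mod_cast (Nat.one_le_floor_iff p).2 hp
  linarith

theorem pow_hits {M : ℕ} (S : Finset κ) (p : κ → ℝ) (u : κ → Fin M) (b : ℝ) :
    b ^ hits S p u = ∏ k, if k ∈ S ∧ ((u k : ℕ) : ℝ) + 1 ≤ p k then b else 1 := by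
  rw [hits, ← prod_const, prod_filter]
  simp only [ite_and]
  rw [prod_ite_mem]
  simp

/-- By independence the moment is a product of factors 1 + (b - 1)q ≤ exp((b - 1)q). The bases b = 2
and b = 1/2 yield the two tails below. -/
theorem avg_pow_hits_le {M : ℕ} (hM : 0 < M) (S : Finset κ) (p : κ → ℝ) (b : ℝ) (hb : 0 ≤ b) :
    avg (fun u : κ → Fin M => b ^ hits S p u)
      ≤ Real.exp ((b - 1) * ∑ k ∈ S,
        avg (fun a : Fin M => if ((a : ℕ) : ℝ) + 1 ≤ p k then (1 : ℝ) else 0)) := by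
  have : Nonempty (Fin M) := ⟨⟨0, hM⟩⟩
  simp only [pow_hits]
  rw [avg_prod (fun k (a : Fin M) => if k ∈ S ∧ ((a : ℕ) : ℝ) + 1 ≤ p k then b else 1),
    mul_sum, Real.exp_sum]
  rw [← prod_subset (subset_univ S)]
  · refine prod_le_prod (fun k _ => avg_nonneg fun a => by split_ifs <;> linarith) fun k hk => ?_
    have : (fun a : Fin M => if k ∈ S ∧ ((a : ℕ) : ℝ) + 1 ≤ p k then b else 1)
        = fun a : Fin M => 1 + (b - 1) * (if ((a : ℕ) : ℝ) + 1 ≤ p k then (1 : ℝ) else 0) := by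
      funext a
      split_ifs <;> simp_all
    rw [this, avg_add, avg_const, avg_mul_left, add_comm]
    exact Real.add_one_le_exp _
  · intro k _ hk
    simp only [hk, false_and, if_false]
    exact avg_const 1

/-- Upper tail of the number of hits. -/
theorem pr_hits_ge_le {M : ℕ} (hM : 0 < M) (S : Finset κ) (p : κ → ℝ) {μ a : ℝ}
    (hμ : ∑ k ∈ S, avg (fun a : Fin M => if ((a : ℕ) : ℝ) + 1 ≤ p k then (1 : ℝ) else 0) ≤ μ) :
    pr (fun u : κ → Fin M => a ≤ hits S p u) ≤ Real.exp (μ - a * Real.log 2) := by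
  have h2 : (0 : ℝ) < 2 ^ a := Real.rpow_pos_of_pos (by norm_num) _
  calc _ ≤ pr (fun u : κ → Fin M => (2 : ℝ) ^ a ≤ 2 ^ hits S p u) := by
        refine pr_mono fun u hu => ?_
        rw [← Real.rpow_natCast]
        exact Real.rpow_le_rpow_of_exponent_le (by norm_num) hu
    _ ≤ avg (fun u : κ → Fin M => (2 : ℝ) ^ hits S p u) / 2 ^ a :=
        pr_le_avg_div (fun u => by positivity) h2
    _ ≤ Real.exp μ / 2 ^ a := by
        gcongr
        refine (avg_pow_hits_le hM S p 2 (by norm_num)).trans (Real.exp_le_exp.2 ?_)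
        linarith
    _ = _ := by
        rw [Real.exp_sub, mul_comm a, Real.exp_mul, Real.exp_log (by norm_num)]

/-- Lower tail of the number of hits. -/
theorem pr_hits_le_le {M : ℕ} (hM : 0 < M) (S : Finset κ) (p : κ → ℝ) {μ a : ℝ}
    (hμ : μ ≤ ∑ k ∈ S, avg (fun a : Fin M => if ((a : ℕ) : ℝ) + 1 ≤ p k then (1 : ℝ) else 0)) :
    pr (fun u : κ → Fin M => hits S p u ≤ a) ≤ Real.exp (a * Real.log 2 - μ / 2) := by
  have h2 : (0 : ℝ) < (1 / 2) ^ a := Real.rpow_pos_of_pos (by norm_num) _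
  calc _ ≤ pr (fun u : κ → Fin M => (1 / 2 : ℝ) ^ a ≤ (1 / 2) ^ hits S p u) := by
        refine pr_mono fun u hu => ?_
        rw [← Real.rpow_natCast]
        exact Real.rpow_le_rpow_of_exponent_ge (by norm_num) (by norm_num) hu
    _ ≤ avg (fun u : κ → Fin M => (1 / 2 : ℝ) ^ hits S p u) / (1 / 2) ^ a :=
        pr_le_avg_div (fun u => by positivity) h2
    _ ≤ Real.exp (- (μ / 2)) / (1 / 2) ^ a := by
        gcongr
        refine (avg_pow_hits_le hM S p (1 / 2) (by norm_num)).trans (Real.exp_le_exp.2 ?_)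
        linarith
    _ = _ := by
        rw [show (1 / 2 : ℝ) = 2⁻¹ by norm_num, Real.inv_rpow (by norm_num), div_inv_eq_mul,
          sub_eq_neg_add, Real.exp_add, mul_comm a, Real.exp_mul, Real.exp_log (by norm_num)]

end FiniteProb

/-! ### Consequences of approximate invertibility, and properties of c_f. -/

namespace ApproxInvertible

open Finset

variable {f : ℝ≥0 → ℝ≥0} {θ θ' θ'' : ℝ≥0}

theorem mono (hf : ApproxInvertible f θ θ' θ'') {x y : ℝ≥0} (h : x ≤ y) : f x ≤ f y := by
  obtain ⟨z, rfl⟩ := exists_add_of_le h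
  exact le_self_add.trans (hf.superadditive x z)

theorem map_zero (hf : ApproxInvertible f θ θ' θ'') : f 0 = 0 := by
  have := hf.superadditive 0 0
  rw [add_zero] at this
  exact nonpos_iff_eq_zero.1 (by simpa using this)

theorem sum_le (hf : ApproxInvertible f θ θ' θ'') {ι : Type*} (t : Finset ι) (x : ι → ℝ≥0) :
    ∑ i ∈ t, f (x i) ≤ f (∑ i ∈ t, x i) := by
  classical
  induction t using Finset.induction_on with
  | empty => simp
  | insert a t ha ih =>
    rw [sum_insert ha, sum_insert ha]
    exact (add_le_add le_rfl ih).trans (hf.superadditive _ _)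

theorem ratio_pos (hf : ApproxInvertible f θ θ' θ'') : 0 < 4 * NNReal.sqrt θ * θ' := by
  have h1 := hf.one_lt
  have h2 := hf.one_lt'
  have : 0 < NNReal.sqrt θ := NNReal.sqrt_pos.2 (by positivity)
  positivity

theorem one_lt_sqrt (hf : ApproxInvertible f θ θ' θ'') : 1 < NNReal.sqrt θ := by
  rw [← NNReal.sqrt_one]
  exact NNReal.sqrt_lt_sqrt.2 hf.one_lt

theorem le_ratio (hf : ApproxInvertible f θ θ' θ'') :
    4 * NNReal.sqrt θ ≤ 4 * NNReal.sqrt θ * θ' :=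
  le_mul_of_one_le_right (by positivity) hf.one_lt'.le

/-- The form in which `shrink` is used: losing a factor up to 4√θ in the argument costs one factor
θ''. -/
theorem le_of_le_ratio_mul (hf : ApproxInvertible f θ θ' θ'') {y z : ℝ≥0}
    (h : y ≤ 4 * NNReal.sqrt θ * z) : f y ≤ θ'' * f z := by
  have h1 := hf.shrink y
  rw [div_le_iff₀' (zero_lt_one.trans hf.one_lt'')] at h1
  refine h1.trans (mul_le_mul_right (hf.mono ?_) _)
  rw [div_le_iff₀' hf.ratio_pos]
  exact h.trans (mul_le_mul_left hf.le_ratio z)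

/-- With z = y/(4√θ θ'), growth and superadditivity give f(y) ≥ θ f(y/θ') ≥ 4θ f(z), while `shrink`
gives f(y) ≤ θ'' f(z). This later makes log(sθ'')/log θ at least 1. -/
theorem four_mul_le (hf : ApproxInvertible f θ θ' θ'') {y : ℝ≥0} (hy : f y ≠ 0) :
    4 * θ ≤ θ'' := by
  have h0 : θ' ≠ 0 := (zero_lt_one.trans hf.one_lt').ne'
  set z := y / (4 * NNReal.sqrt θ * θ') with hz
  have h1 := hf.shrink y
  rw [div_le_iff₀' (zero_lt_one.trans hf.one_lt'')] at h1
  have h2 : 4 * f z ≤ f (y / θ') := by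
    have h3 := hf.sum_le (univ : Finset (Fin 4)) (fun _ => z)
    simp only [sum_const, card_univ, Fintype.card_fin, nsmul_eq_mul] at h3
    refine h3.trans (hf.mono ?_)
    push_cast
    rw [le_div_iff₀ (zero_lt_one.trans hf.one_lt')]
    calc 4 * z * θ' ≤ 4 * z * θ' * NNReal.sqrt θ :=
          le_mul_of_one_le_right (by positivity) hf.one_lt_sqrt.le
      _ = z * (4 * NNReal.sqrt θ * θ') := by ring
      _ = y := div_mul_cancel₀ _ hf.ratio_pos.ne'
      _ ≤ _ := le_rfl
  have h3 := hf.growth (y / θ')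
  rw [mul_div_cancel₀ _ h0] at h3
  have h4 : 4 * θ * f z ≤ θ'' * f z := by
    calc 4 * θ * f z = θ * (4 * f z) := by ring
      _ ≤ θ * f (y / θ') := mul_le_mul_right h2 _
      _ ≤ f y := h3
      _ ≤ _ := h1
  refine le_of_mul_le_mul_right h4 (pos_iff_ne_zero.2 fun h => hy ?_)
  simpa [← hz, h] using h1

/-- Needed because the infimum of the empty set would be 0. The sum is at most 4^s times its largest
term, and each factor 4 costs one θ''. -/
theorem cParam_set_nonempty (hf : ApproxInvertible f θ θ' θ'') {s : ℕ} (hs : 1 ≤ s) :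
    {c : ℝ≥0 | ∀ y : Fin s → ℝ≥0,
      f (∑ j, y j) ≤ c / s * (∑ j, NNReal.sqrt (f (y j))) ^ 2}.Nonempty := by
  refine ⟨s * θ'' ^ s, fun y => ?_⟩
  have hs0 : (s : ℝ≥0) ≠ 0 := Nat.cast_ne_zero.2 (by omega)
  rw [mul_div_assoc, mul_div_cancel₀ _ hs0]
  have key : ∀ (r : ℕ) (z z' : ℝ≥0), z ≤ 4 ^ r * z' → f z ≤ θ'' ^ r * f z' := by
    intro r
    induction r with
    | zero => intro z z' h; simpa using hf.mono (by simpa using h)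
    | succ r ih =>
      intro z z' h
      have h4 : z / 4 ≤ 4 ^ r * z' := by
        rw [div_le_iff₀' (by norm_num)]
        exact h.trans_eq (by ring)
      have h5 : f z ≤ θ'' * f (z / 4) := by
        refine hf.le_of_le_ratio_mul ?_
        calc z = 4 * (z / 4) := by rw [mul_div_cancel₀ _ (by norm_num)]
          _ ≤ _ := mul_le_mul_left (le_mul_of_one_le_right (by norm_num) hf.one_lt_sqrt.le) _
      calc f z ≤ θ'' * (θ'' ^ r * f z') := h5.trans (mul_le_mul_right (ih _ _ h4) _)
        _ = _ := by ring
  have : Nonempty (Fin s) := ⟨⟨0, hs⟩⟩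
  obtain ⟨j0, -, hj0⟩ := exists_max_image (univ : Finset (Fin s)) y univ_nonempty
  have h1 : ∑ j, y j ≤ 4 ^ s * y j0 := by
    calc ∑ j, y j ≤ ∑ _j : Fin s, y j0 := sum_le_sum fun j hj => hj0 j hj
      _ = s * y j0 := by simp
      _ ≤ _ := by
        gcongr
        exact_mod_cast (Nat.lt_pow_self (by norm_num : 1 < 4)).le
  refine (key s _ _ h1).trans (mul_le_mul_right ?_ _)
  calc f (y j0) = NNReal.sqrt (f (y j0)) ^ 2 := (NNReal.sq_sqrt _).symm
    _ ≤ _ := by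
      gcongr
      exact single_le_sum (f := fun j => NNReal.sqrt (f (y j))) (fun _ _ => zero_le) (mem_univ j0)

/-- The infimum is attained: each y imposes a closed lower bound on c, unless the sum of roots is 0,
where any admissible c already forces the left side to vanish. -/
theorem cParam_spec (hf : ApproxInvertible f θ θ' θ'') {s : ℕ} (hs : 1 ≤ s) (y : Fin s → ℝ≥0) :
    f (∑ j, y j) ≤ cParam f s / s * (∑ j, NNReal.sqrt (f (y j))) ^ 2 := by
  have hs0 : (s : ℝ≥0) ≠ 0 := Nat.cast_ne_zero.2 (by omega)
  obtain ⟨c, hc⟩ := hf.cParam_set_nonempty hs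
  rcases eq_or_ne ((∑ j, NNReal.sqrt (f (y j))) ^ 2) 0 with h | h
  · have := hc y
    rw [h] at this ⊢
    simpa using this
  · have hpos : 0 < (∑ j, NNReal.sqrt (f (y j))) ^ 2 := pos_iff_ne_zero.2 h
    rw [← div_le_iff₀ hpos, le_div_iff₀ (pos_iff_ne_zero.2 hs0)]
    refine le_csInf ⟨c, hc⟩ fun c' hc' => ?_
    rw [← le_div_iff₀ (pos_iff_ne_zero.2 hs0), div_le_iff₀ hpos]
    exact hc' y

/-- Fewer than s summands are padded with zeros, which is harmless as f(0) = 0. -/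
theorem cParam_finset (hf : ApproxInvertible f θ θ' θ'') {s : ℕ} (hs : 1 ≤ s) {ι : Type*}
    (t : Finset ι) (ht : #t ≤ s) (y : ι → ℝ≥0) :
    f (∑ i ∈ t, y i) ≤ cParam f s / s * (∑ i ∈ t, NNReal.sqrt (f (y i))) ^ 2 := by
  set e : t ↪ Fin s := t.equivFin.toEmbedding.trans (Fin.castLEEmb ht) with he
  set y' : Fin s → ℝ≥0 := Function.extend e (fun i : t => y i) 0 with hy'
  have key : ∀ φ : ℝ≥0 → ℝ≥0, φ 0 = 0 → ∑ j, φ (y' j) = ∑ i ∈ t, φ (y i) := by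
    intro φ hφ
    rw [← sum_attach t, ← sum_subset (subset_univ (univ.map e)), sum_map]
    · refine sum_congr rfl fun i _ => ?_
      rw [hy', e.injective.extend_apply]
    · intro j _ hj
      rw [hy', Function.extend_apply']
      · exact hφ
      · rintro ⟨i, rfl⟩
        exact hj (mem_map_of_mem _ (mem_univ i))
  have h := hf.cParam_spec hs y'
  rw [key (fun z => NNReal.sqrt (f z)) (by simp [hf.map_zero])] at h
  have h2 := key id rfl
  simp only [id] at h2
  rwa [h2] at h

/-- Test the defining inequality on (y, 0, …, 0). -/
theorem le_cParam (hf : ApproxInvertible f θ θ' θ'') {s : ℕ} (hs : 1 ≤ s) {y : ℝ≥0}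
    (hy : f y ≠ 0) : (s : ℝ≥0) ≤ cParam f s := by
  have hs0 : (s : ℝ≥0) ≠ 0 := Nat.cast_ne_zero.2 (by omega)
  have h := hf.cParam_finset hs ({()} : Finset Unit) (by simpa using hs) (fun _ => y)
  simp only [sum_singleton, NNReal.sq_sqrt] at h
  have h1 : 1 * f y ≤ cParam f s / s * f y := by simpa using h
  have h2 := le_of_mul_le_mul_right h1 (pos_iff_ne_zero.2 hy)
  rwa [le_div_iff₀ (pos_iff_ne_zero.2 hs0), one_mul] at h2

end ApproxInvertible

/-! ### Random weights and the threshold-sampling estimator. -/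

namespace FiniteProb

open Finset
open scoped Classical

/-- The exponent `z` with `w ^ z ≤ x < w ^ (z + 1)`. -/
def lg (w x : ℝ≥0) : ℤ := if h : ∃ z : ℤ, w ^ z ≤ x ∧ x < w ^ (z + 1) then h.choose else 0

theorem lg_spec {w x : ℝ≥0} (hw : 1 < w) (hx : x ≠ 0) : w ^ lg w x ≤ x ∧ x < w ^ (lg w x + 1) := by
  have h : ∃ z : ℤ, w ^ z ≤ x ∧ x < w ^ (z + 1) := by
    obtain ⟨z, hz⟩ := NNReal.exists_mem_Ico_zpow hx hw
    exact ⟨z, hz.1, hz.2⟩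
  rw [lg, dif_pos h]
  exact h.choose_spec

variable {ι : Type*}

/-- The random weight `1 / h` of a coordinate, for `h` uniform in `{1 / M, …, M / M}`. -/
def wt {M : ℕ} (m : ι → Fin M) (i : ι) : ℝ≥0 := M / ((m i : ℕ) + 1)

theorem le_mul_wt_iff {M : ℕ} (m : ι → Fin M) (i : ι) {a τ : ℝ≥0} (hτ : 0 < τ) :
    τ ≤ a * wt m i ↔ ((m i : ℕ) : ℝ) + 1 ≤ a * M / τ := by
  rw [wt, ← mul_div_assoc, le_div_iff₀ (by positivity), le_div_iff₀ (by exact_mod_cast hτ),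
    mul_comm]
  rw [← NNReal.coe_le_coe]
  push_cast
  rfl

/-- The threshold-sampling estimator of `∑ a i`, restricted to `R`: a coordinate is sampled if its
weighted value is at least `τ`, and it is divided by the probability of this event. -/
def est {M : ℕ} (R : Finset ι) (a : ι → ℝ≥0) (m : ι → Fin M) (τ : ℝ≥0) : ℝ :=
  ∑ i ∈ R, if τ ≤ a i * wt m i then (a i : ℝ) / ((min M ⌊(a i * M / τ : ℝ)⌋₊ : ℕ) / M) else 0

variable [Fintype ι]

/-- A weight has mean the harmonic number of M, at most 1 + log M; then Markov. -/
theorem pr_sum_wt_ge_le {M : ℕ} (hM : 1 ≤ M) (a : ι → ℝ≥0) (ha : 0 < ∑ i, a i) :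
    pr (fun m : ι → Fin M => 100 * ((∑ i, a i : ℝ≥0) : ℝ) * (1 + Real.log M)
      ≤ ((∑ i, a i * wt m i : ℝ≥0) : ℝ)) ≤ 1 / 100 := by
  have hl : 0 ≤ Real.log M := Real.log_natCast_nonneg M
  have hF : (0 : ℝ) < (∑ i, a i : ℝ≥0) := by exact_mod_cast ha
  have : Nonempty (Fin M) := ⟨⟨0, hM⟩⟩
  have havg : avg (fun m : ι → Fin M => ((∑ i, a i * wt m i : ℝ≥0) : ℝ))
      ≤ (∑ i, a i : ℝ≥0) * (1 + Real.log M) := by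
    push_cast
    rw [avg_sum, sum_mul]
    refine sum_le_sum fun i _ => ?_
    rw [avg_mul_left]
    refine mul_le_mul_of_nonneg_left ?_ (a i).2
    have h1 : avg (fun m : ι → Fin M => ((wt m i : ℝ≥0) : ℝ)) = (harmonic M : ℝ) := by
      have := avg_coord i (fun b : Fin M => (M : ℝ) / ((b : ℕ) + 1))
      simp only [wt]
      push_cast
      rw [this]
      have hM0 : (M : ℝ) ≠ 0 := Nat.cast_ne_zero.2 (by omega)
      simp only [avg, Fintype.card_fin]
      rw [sum_div, Fin.sum_univ_eq_sum_range (fun b => (M : ℝ) / ((b : ℝ) + 1) / M) M, harmonic]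
      push_cast
      refine sum_congr rfl fun b _ => ?_
      field_simp
    rw [h1]
    exact harmonic_le_one_add_log M
  refine (pr_le_avg_div (fun m => NNReal.coe_nonneg _) (by positivity)).trans ?_
  rw [div_le_div_iff₀ (by positivity) (by norm_num)]
  linarith

/-- Unlike the sum, the maximum involves no logarithm: a single weighted value reaches t with
probability at most a_i/t, and these probabilities are added. -/
theorem pr_wt_ge_le {M : ℕ} (hM : 1 ≤ M) (a : ι → ℝ≥0) (ha : 0 < ∑ i, a i) :
    pr (fun m : ι → Fin M => ∃ i ∈ univ, 100 * (∑ i, a i) ≤ a i * wt m i) ≤ 1 / 100 := by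
  have : Nonempty (Fin M) := ⟨⟨0, hM⟩⟩
  have hF : (0 : ℝ) < ∑ i, (a i : ℝ) := by exact_mod_cast ha
  have hM0 : (M : ℝ) ≠ 0 := Nat.cast_ne_zero.2 (by omega)
  refine (pr_exists_le _ _).trans ?_
  have h : ∀ i, pr (fun m : ι → Fin M => 100 * (∑ i, a i) ≤ a i * wt m i)
      ≤ (a i : ℝ) * (1 / (100 * ∑ i, (a i : ℝ))) := by
    intro i
    simp only [le_mul_wt_iff _ i (show 0 < 100 * ∑ i, a i by positivity)]
    unfold pr
    rw [avg_coord i (fun b : Fin M => if ((b : ℕ) : ℝ) + 1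
      ≤ a i * M / (100 * ∑ i, a i : ℝ≥0) then (1 : ℝ) else 0)]
    refine (avg_hit_le _ (by positivity)).trans_eq ?_
    push_cast
    field_simp
  refine (sum_le_sum fun i _ => h i).trans_eq ?_
  rw [← sum_mul]
  field_simp

/-- Chebyshev's inequality for the threshold-sampling estimator. -/
theorem pr_est_le {M : ℕ} (hM : 1 ≤ M) (hc : Fintype.card ι ≤ M) (a : ι → ℝ≥0) {τ η : ℝ≥0}
    (hτ : 0 < τ) (hη : 0 < η) (ha : 0 < ∑ i, a i) (hτη : 2 * τ ≤ η * ∑ i, a i) :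
    pr (fun m : ι → Fin M => ((η * ∑ i, a i : ℝ≥0) : ℝ) < |est univ a m τ - (∑ i, a i : ℝ≥0)|)
      ≤ 8 * τ / (η ^ 2 * (∑ i, a i : ℝ≥0)) := by
  have : Nonempty (Fin M) := ⟨⟨0, hM⟩⟩
  have hM0 : (0 : ℝ) < M := Nat.cast_pos.2 hM
  have hτ' : (0 : ℝ) < τ := hτ
  set F : ℝ := ((∑ i, a i : ℝ≥0) : ℝ) with hF
  have hFs : F = ∑ i, (a i : ℝ) := by rw [hF]; push_cast; rfl
  have hF0 : 0 < F := ha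
  have hη' : (0 : ℝ) < η := hη
  have hτη' : 2 * (τ : ℝ) ≤ η * F := by exact_mod_cast hτη
  set q : ι → ℝ := fun i => ((min M ⌊(a i * M / τ : ℝ)⌋₊ : ℕ) : ℝ) / M with hq
  set Y : ι → Fin M → ℝ := fun i b =>
    (a i / q i) * (if ((b : ℕ) : ℝ) + 1 ≤ a i * M / τ then (1 : ℝ) else 0) with hY
  have hest : ∀ m : ι → Fin M, est univ a m τ = ∑ i, Y i (m i) := by
    intro m
    refine sum_congr rfl fun i _ => ?_
    rw [hY]
    simp only [le_mul_wt_iff m i hτ, mul_ite, mul_one, mul_zero, hq]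
  have hq0 : ∀ i, 0 ≤ q i := fun i => by positivity
  have hZ : ∀ i, avg (fun b : Fin M => if ((b : ℕ) : ℝ) + 1 ≤ a i * M / τ then (1 : ℝ) else 0)
      = q i := fun i => avg_hit _ (by positivity)
  have hm1 : ∀ i, avg (Y i) = a i / q i * q i := fun i => by rw [hY, avg_mul_left, hZ]
  have hm2 : ∀ i, avg (fun b => Y i b ^ 2) = (a i / q i) ^ 2 * q i := by
    intro i
    have h1 : (fun b => Y i b ^ 2) = fun b : Fin M =>
        ((a i : ℝ) / q i) ^ 2 * (if ((b : ℕ) : ℝ) + 1 ≤ a i * M / τ then (1 : ℝ) else 0) := by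
      funext b
      simp only [hY]
      rw [mul_pow]
      split_ifs <;> simp
    rw [h1, avg_mul_left, hZ]
  -- If q i = 0, the summand vanishes and is biased, but then a i < τ/M. With at most M coordinates
  -- the total bias is at most τ.
  have hmean : ∀ i, (a i : ℝ) - τ / M ≤ avg (Y i) ∧ avg (Y i) ≤ a i := by
    intro i
    rw [hm1]
    rcases eq_or_ne (q i) 0 with h | h
    · refine ⟨?_, by simp [h]⟩
      rw [h, mul_zero, sub_nonpos]
      have h1 : min M ⌊(a i * M / τ : ℝ)⌋₊ = 0 := by
        exact_mod_cast (div_eq_zero_iff.1 h).resolve_right hM0.ne'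
      have h2 : ⌊(a i * M / τ : ℝ)⌋₊ = 0 := by omega
      rw [Nat.floor_eq_zero, div_lt_one hτ'] at h2
      exact ((lt_div_iff₀ hM0).2 h2).le
    · rw [div_mul_cancel₀ _ h]
      exact ⟨by linarith [div_nonneg hτ'.le hM0.le], le_rfl⟩
  -- For 0 < q i < 1 the second moment is a i · (a i / q i), and a i / q i ≤ 2τ because the floor
  -- loses at most a factor of two. For q i = 1 the variance is 0.
  have hvar : ∀ i, avg (fun b => Y i b ^ 2) - avg (Y i) ^ 2 ≤ 2 * τ * a i := by
    intro i
    rw [hm1, hm2]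
    have hai : (0 : ℝ) ≤ a i := (a i).2
    rcases eq_or_ne (q i) 0 with h | h
    · simp [h]; positivity
    · rw [div_mul_cancel₀ _ h]
      have hqp : 0 < q i := lt_of_le_of_ne (hq0 i) h.symm
      have h3 : ((a i : ℝ) / q i) ^ 2 * q i = a i * (a i / q i) := by field_simp
      rw [h3]
      by_cases hlt : ⌊(a i * M / τ : ℝ)⌋₊ < M
      · have h4 : q i = (⌊(a i * M / τ : ℝ)⌋₊ : ℝ) / M := by
          rw [hq]; simp only; rw [min_eq_right hlt.le]
        have h5 : (1 : ℝ) ≤ ⌊(a i * M / τ : ℝ)⌋₊ := by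
          have : ⌊(a i * M / τ : ℝ)⌋₊ ≠ 0 := fun h0 => h (by rw [h4, h0]; simp)
          exact_mod_cast Nat.one_le_iff_ne_zero.2 this
        have h6 := Nat.lt_floor_add_one (a i * M / τ : ℝ)
        have h7 : (a i * M / τ : ℝ) ≤ 2 * (q i * M) := by
          rw [h4, div_mul_cancel₀ _ hM0.ne']; linarith
        have h8 : (a i : ℝ) / q i ≤ 2 * τ := by
          rw [div_le_iff₀ hqp]
          rw [div_le_iff₀ hτ'] at h7
          have : (a i : ℝ) * M ≤ (2 * τ * q i) * M := by linarith
          exact le_of_mul_le_mul_right this hM0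
        nlinarith [sq_nonneg (a i : ℝ)]
      · have h4 : q i = 1 := by
          rw [hq]; simp only; rw [min_eq_left (not_lt.1 hlt), div_self hM0.ne']
        rw [h4, div_one, sq, sub_self]
        positivity
  have hsum1 : |(∑ i, avg (Y i)) - F| ≤ η * F / 2 := by
    rw [abs_le]
    have h1 : ∑ i, ((a i : ℝ) - τ / M) ≤ ∑ i, avg (Y i) := sum_le_sum fun i _ => (hmean i).1
    have h2 : ∑ i, avg (Y i) ≤ ∑ i, (a i : ℝ) := sum_le_sum fun i _ => (hmean i).2
    rw [sum_sub_distrib, sum_const, card_univ, nsmul_eq_mul] at h1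
    have h3 : (Fintype.card ι : ℝ) * (τ / M) ≤ τ := by
      rw [← mul_div_assoc, div_le_iff₀ hM0, mul_comm]
      gcongr
    constructor
    · linarith
    · nlinarith [mul_pos hη' hF0]
  have hpos : 0 < η * F / 2 := by positivity
  calc _ ≤ pr (fun m : ι → Fin M => η * F / 2 ≤ |∑ i, Y i (m i) - ∑ i, avg (Y i)|) := by
        refine pr_mono fun m hm => ?_
        rw [hest] at hm
        push_cast at hm
        rw [← hFs] at hm
        have := abs_sub_le (∑ i, Y i (m i)) (∑ i, avg (Y i)) F
        linarith
    _ ≤ _ := pr_abs_sub_ge_le Y hpos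
    _ ≤ (2 * τ * F) / (η * F / 2) ^ 2 := by
        gcongr
        rw [hFs, mul_sum]
        exact sum_le_sum fun i _ => hvar i
    _ = _ := by field_simp; ring

/-- The threshold used by the estimator if the largest weighted value is `V`. -/
def thr (ε V : ℝ≥0) : ℝ≥0 := 2 ^ lg 2 (ε ^ 2 * V / 10 ^ 6)

/-- The event that the random weights allow estimating `∑ a i`. -/
structure GoodWeights {M : ℕ} (a : ι → ℝ≥0) (ε : ℝ≥0) (m : ι → Fin M) : Prop where
  sum_le : ((∑ i, a i * wt m i : ℝ≥0) : ℝ) ≤ 100 * ((∑ i, a i : ℝ≥0) : ℝ) * (1 + Real.log M)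
  exists_le : ∃ i, (∑ i, a i) / 3200 ≤ a i * wt m i
  est_le : ∀ V, (∀ i, a i * wt m i ≤ V) → (∃ i, V = a i * wt m i) →
    |est univ a m (thr ε V) - (∑ i, a i : ℝ≥0)| ≤ ε * (∑ i, a i : ℝ≥0)

/-- The difficulty is that `thr ε V` depends on the weights through their maximum V. Outside two
events of probability at most 1/100 each, F/3200 ≤ V < 100F, so the rounded threshold is one of 21
fixed powers of two. -/
theorem pr_not_goodWeights_le {M : ℕ} (hM : 1 ≤ M) (hc : Fintype.card ι ≤ M) (a : ι → ℝ≥0)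
    {ε : ℝ≥0} (hε : 0 < ε) (hε1 : ε < 1) (ha : 0 < ∑ i, a i) :
    pr (fun m : ι → Fin M => ¬ GoodWeights a ε m) ≤ 47 / 1000 := by
  set F := ∑ i, a i with hF
  have hF' : (0 : ℝ) < F := ha
  have hε' : (0 : ℝ) < ε := hε
  set z0 := lg 2 (ε ^ 2 * F / 10 ^ 4) with hz0
  have hz0s := lg_spec (w := 2) (x := ε ^ 2 * F / 10 ^ 4) one_lt_two (by positivity)
  rw [← hz0] at hz0s
  have h1 := pr_sum_wt_ge_le hM a ha
  have h2 := pr_wt_ge_le hM a ha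
  have h3 := pr_est_le hM hc a (τ := F / 3200) (η := 1 / 2) (by positivity) (by norm_num) ha (by
    rw [← hF, ← NNReal.coe_le_coe]; push_cast; linarith)
  have h3' : 8 * ((F / 3200 : ℝ≥0) : ℝ) / (((1 / 2 : ℝ≥0) : ℝ) ^ 2 * (∑ i, a i : ℝ≥0)) = 1 / 100 := by
    rw [← hF]; push_cast; field_simp; norm_num
  rw [h3'] at h3
  -- `z0` is the exponent for V = 100F, and 20 steps down suffice since 100 · 3200 < 2^20. Each
  -- threshold fails with probability at most 8/10^4.
  have h4 : pr (fun m : ι → Fin M => ∃ z ∈ Icc (z0 - 20) z0,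
      ((ε * ∑ i, a i : ℝ≥0) : ℝ) < |est univ a m (2 ^ z) - (∑ i, a i : ℝ≥0)|) ≤ 17 / 1000 := by
    refine (pr_exists_le _ _).trans ?_
    have : ∀ z ∈ Icc (z0 - 20) z0, pr (fun m : ι → Fin M =>
        ((ε * ∑ i, a i : ℝ≥0) : ℝ) < |est univ a m (2 ^ z) - (∑ i, a i : ℝ≥0)|) ≤ 8 / 10 ^ 4 := by
      intro z hz
      have hle : (2 : ℝ≥0) ^ z ≤ ε ^ 2 * F / 10 ^ 4 :=
        (zpow_le_zpow_right₀ one_le_two (mem_Icc.1 hz).2).trans hz0s.1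
      have hle' : (((2 : ℝ≥0) ^ z : ℝ≥0) : ℝ) ≤ ε ^ 2 * F / 10 ^ 4 := by exact_mod_cast hle
      refine (pr_est_le hM hc a (by positivity) hε ha ?_).trans ?_
      · rw [← hF, ← NNReal.coe_le_coe, NNReal.coe_mul]
        have : (ε : ℝ) < 1 := hε1
        have h5 : (ε : ℝ) ^ 2 * F ≤ ε * F := by
          refine mul_le_mul_of_nonneg_right ?_ hF'.le
          nlinarith
        rw [NNReal.coe_mul, NNReal.coe_ofNat]
        linarith
      · rw [← hF, div_le_div_iff₀ (by positivity) (by norm_num)]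
        linarith
    refine (sum_le_sum this).trans ?_
    rw [sum_const, Int.card_Icc]
    have : (z0 + 1 - (z0 - 20)).toNat = 21 := by
      have : z0 + 1 - (z0 - 20) = 21 := by ring
      rw [this]; rfl
    rw [this]
    norm_num
  refine le_trans (pr_mono (q := fun m => ((100 * (F : ℝ) * (1 + Real.log M)
      ≤ ((∑ i, a i * wt m i : ℝ≥0) : ℝ)) ∨ (∃ i ∈ univ, 100 * F ≤ a i * wt m i)) ∨
      (((1 / 2 * F : ℝ≥0) : ℝ) < |est univ a m (F / 3200) - F| ∨
      (∃ z ∈ Icc (z0 - 20) z0, ((ε * F : ℝ≥0) : ℝ) < |est univ a m (2 ^ z) - F|))) ?_)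
    (((pr_or_le _ _).trans (add_le_add ((pr_or_le _ _).trans (add_le_add h1 h2))
      ((pr_or_le _ _).trans (add_le_add h3 h4)))).trans (by norm_num))
  intro m hm
  by_contra hcon
  push Not at hcon
  obtain ⟨⟨g1, g2⟩, g3, g4⟩ := hcon
  refine hm ⟨g1.le, ?_, ?_⟩
  -- If no weighted value reached F/3200, the estimator with this threshold would be 0, an error of
  -- F > F/2.
  · by_contra hno
    push Not at hno
    have : est univ a m (F / 3200) = 0 := by
      refine sum_eq_zero fun i _ => ?_
      rw [if_neg (not_le.2 (hno i))]
    rw [this, zero_sub, abs_neg, abs_of_pos hF'] at g3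
    push_cast at g3
    linarith
  · intro V hV ⟨i, hi⟩
    have hex : F / 3200 ≤ V := by
      by_contra hno
      have : est univ a m (F / 3200) = 0 := by
        refine sum_eq_zero fun i _ => ?_
        rw [if_neg]
        exact fun h => hno (h.trans (hV i))
      rw [this, zero_sub, abs_neg, abs_of_pos hF'] at g3
      push_cast at g3
      linarith
    have hV100 : V < 100 * F := hi ▸ g2 i (mem_univ i)
    have hV0 : 0 < V := lt_of_lt_of_le (by positivity) hex
    have hs := lg_spec (w := 2) (x := ε ^ 2 * V / 10 ^ 6) one_lt_two (by positivity)
    have := g4 (lg 2 (ε ^ 2 * V / 10 ^ 6)) ?_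
    · rw [← NNReal.coe_mul]
      exact this
    rw [mem_Icc]
    have hV100' : (V : ℝ) < 100 * F := by exact_mod_cast hV100
    have hex' : (F : ℝ) / 3200 ≤ V := by exact_mod_cast hex
    have e2 : (0 : ℝ) < ε ^ 2 := by positivity
    constructor
    · have hlt : (2 : ℝ≥0) ^ (z0 - 20) < 2 ^ (lg 2 (ε ^ 2 * V / 10 ^ 6) + 1) := by
        refine lt_of_le_of_lt ?_ hs.2
        rw [zpow_sub₀ two_ne_zero, div_le_iff₀ (by positivity)]
        refine hz0s.1.trans ?_
        rw [← NNReal.coe_le_coe]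
        push_cast
        have : (ε : ℝ) ^ 2 * (F / 3200) ≤ ε ^ 2 * V := mul_le_mul_of_nonneg_left hex' e2.le
        norm_num
        nlinarith
      have := (zpow_lt_zpow_iff_right₀ (one_lt_two (α := ℝ≥0))).1 hlt
      omega
    · have hlt : (2 : ℝ≥0) ^ (lg 2 (ε ^ 2 * V / 10 ^ 6)) < 2 ^ (z0 + 1) := by
        refine lt_of_le_of_lt (hs.1.trans ?_) hz0s.2
        rw [← NNReal.coe_le_coe]
        push_cast
        have : (ε : ℝ) ^ 2 * V ≤ ε ^ 2 * (100 * F) := mul_le_mul_of_nonneg_left hV100'.le e2.le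
        linarith
      have := (zpow_lt_zpow_iff_right₀ (one_lt_two (α := ℝ≥0))).1 hlt
      omega

end FiniteProb

/-! ### Finding the heavy coordinates from samples. -/

namespace FiniteProb

open Finset
open scoped Classical

variable {ι : Type*} {s T M M' : ℕ}

/-- The servers whose value in coordinate `i` has exponent `z`, and whose total weight is at most
`2 / r` times the sum of all weights. -/
def grp (w : ℝ≥0) (x : Fin s → ι → ℝ≥0) (Fh : Fin s → ℝ≥0) (i : ι) (z : ℤ) (r : ℕ) :
    Finset (Fin s) :=
  {j | x j i ≠ 0 ∧ lg w (x j i) = z ∧ r * Fh j ≤ 2 * ∑ j, Fh j}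

/-- The common rate at which the coordinate `i` is sampled by the servers in a group. -/
def rate (f : ℝ≥0 → ℝ≥0) (w : ℝ≥0) (m : ι → Fin M) (Fh : Fin s → ℝ≥0) (i : ι) (z : ℤ) (r : ℕ) :
    ℝ≥0 :=
  f (w ^ z) * wt m i * r / (2 * ∑ j, Fh j)

/-- The number of samples of the coordinate `i` in a group. -/
def cnt (f : ℝ≥0 → ℝ≥0) (w : ℝ≥0) (m : ι → Fin M) (u : ι × Fin s × Fin T → Fin M')
    (x : Fin s → ι → ℝ≥0) (Fh : Fin s → ℝ≥0) (i : ι) (z : ℤ) (r : ℕ) : ℕ :=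
  hits ({i} ×ˢ (grp w x Fh i z r ×ˢ univ)) (fun _ => M' * (rate f w m Fh i z r : ℝ)) u

/-- The samples witness that the group has at least `r / 16` members. -/
def Pass (f : ℝ≥0 → ℝ≥0) (w Λ : ℝ≥0) (m : ι → Fin M) (u : ι × Fin s × Fin T → Fin M')
    (x : Fin s → ι → ℝ≥0) (Fh : Fin s → ℝ≥0) (i : ι) (z : ℤ) (r : ℕ) : Prop :=
  1 ≤ r ∧ r ≤ s ∧ rate f w m Fh i z r ≤ 1 ∧ 8 * Λ ≤ T * rate f w m Fh i z r * r ∧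
    T * rate f w m Fh i z r * r ≤ 8 * (cnt f w m u x Fh i z r : ℝ≥0)

/-- The lower bound for the weighted value of a coordinate witnessed by a group. -/
def score (f : ℝ≥0 → ℝ≥0) (w : ℝ≥0) (m : ι → Fin M) (i : ι) (z : ℤ) (r : ℕ) : ℝ≥0 :=
  f (w ^ z * r / 16) * wt m i

theorem cnt_mean_le (f : ℝ≥0 → ℝ≥0) (w : ℝ≥0) (m : ι → Fin M) (x : Fin s → ι → ℝ≥0)
    (Fh : Fin s → ℝ≥0) (i : ι) (z : ℤ) (r : ℕ) (hM' : 0 < M') :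
    ∑ _k ∈ ({i} ×ˢ (grp w x Fh i z r ×ˢ univ) : Finset (ι × Fin s × Fin T)),
      avg (fun a : Fin M' => if ((a : ℕ) : ℝ) + 1 ≤ M' * (rate f w m Fh i z r : ℝ)
        then (1 : ℝ) else 0)
      ≤ #(grp w x Fh i z r) * T * rate f w m Fh i z r := by
  have hM0 : (0 : ℝ) < M' := Nat.cast_pos.2 hM'
  rw [sum_const, card_product, card_product, card_singleton, one_mul, card_univ, Fintype.card_fin,
    nsmul_eq_mul]
  push_cast
  gcongr
  refine (avg_hit_le _ (by positivity)).trans_eq ?_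
  rw [mul_div_cancel_left₀ _ hM0.ne']

/-- Together with r ≤ 16 · #`grp` this makes `score` a true lower bound for the weighted value. -/
theorem sum_grp_le {w : ℝ≥0} (hw : 1 < w) (x : Fin s → ι → ℝ≥0) (Fh : Fin s → ℝ≥0) (i : ι)
    (z : ℤ) (r : ℕ) : w ^ z * #(grp w x Fh i z r) ≤ ∑ j, x j i := by
  calc w ^ z * #(grp w x Fh i z r) = ∑ j ∈ grp w x Fh i z r, w ^ z := by
        rw [sum_const, nsmul_eq_mul, mul_comm]
    _ ≤ ∑ j ∈ grp w x Fh i z r, x j i := by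
        refine sum_le_sum fun j hj => ?_
        obtain ⟨h0, h1, -⟩ := (mem_filter.1 hj).2
        rw [← h1]
        exact (lg_spec hw h0).1
    _ ≤ _ := sum_le_sum_of_subset (subset_univ _)

/-- A coordinate of large weighted value has a large group that witnesses it. -/
theorem exists_grp {f : ℝ≥0 → ℝ≥0} {θ θ' θ'' : ℝ≥0} (hf : ApproxInvertible f θ θ' θ'')
    {Λ : ℝ≥0} {m : ι → Fin M} {x : Fin s → ι → ℝ≥0} {Fh : Fin s → ℝ≥0} {τ L : ℝ≥0} {D N : ℕ}
    (hs : 1 ≤ s) (hN : 2 * (s : ℝ≥0) ≤ NNReal.sqrt θ ^ N) (hND : (N + 1) ^ 2 ≤ D)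
    (hFh : ∀ j i, f (x j i) * wt m i ≤ Fh j) (hFsum : ∑ j, Fh j ≤ 2 * (L * τ)) (hτ : 0 < τ)
    (hT : 32 * Λ * (cParam f s / s) * θ'' ^ 2 * cParam f D * L ≤ T) {i : ι}
    (hi : τ ≤ f (∑ j, x j i) * wt m i) :
    ∃ z r, 1 ≤ r ∧ r ≤ s ∧ r ≤ 2 * #(grp (NNReal.sqrt θ) x Fh i z r) ∧
      rate f (NNReal.sqrt θ) m Fh i z r ≤ 1 ∧
      8 * Λ ≤ T * rate f (NNReal.sqrt θ) m Fh i z r * r ∧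
      f (∑ j, x j i) * wt m i
        ≤ θ'' ^ 3 * cParam f D * score f (NNReal.sqrt θ) m i z r := by
  set w := NNReal.sqrt θ with hw
  have hw1 : 1 < w := hf.one_lt_sqrt
  have hw0 : 0 < w := zero_lt_one.trans hw1
  have hs0 : (0 : ℝ≥0) < s := Nat.cast_pos.2 hs
  set X := ∑ j, x j i with hX
  have hfX : f X ≠ 0 := fun h => by rw [h, zero_mul] at hi; exact absurd hi (not_le.2 hτ)
  have hX0 : 0 < X := pos_iff_ne_zero.2 fun h => hfX (by rw [h]; exact hf.map_zero)
  set J : Finset (Fin s) := {j | X ≤ 2 * s * x j i} with hJ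
  have hJ0 : ∀ j ∈ J, x j i ≠ 0 := by
    intro j hj h
    have := (mem_filter.1 hj).2
    rw [h, mul_zero] at this
    exact absurd this (not_le.2 hX0)
  -- the servers outside `J` hold at most half of `X`
  have hXJ : X ≤ 2 * ∑ j ∈ J, x j i := by
    have h1 : (2 : ℝ≥0) * ∑ j ∈ univ.filter (fun j => ¬ X ≤ 2 * s * x j i), x j i ≤ X := by
      refine le_of_mul_le_mul_left ?_ hs0
      calc (s : ℝ≥0) * (2 * ∑ j ∈ univ.filter (fun j => ¬ X ≤ 2 * s * x j i), x j i)
          = ∑ j ∈ univ.filter (fun j => ¬ X ≤ 2 * s * x j i), 2 * s * x j i := by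
            rw [← mul_sum]; ring
        _ ≤ ∑ _j ∈ univ.filter (fun j => ¬ X ≤ 2 * s * x j i), X :=
            sum_le_sum fun j hj => (not_le.1 (mem_filter.1 hj).2).le
        _ ≤ ∑ _j : Fin s, X := sum_le_sum_of_subset (subset_univ _)
        _ = s * X := by simp
    have h2 := sum_filter_add_sum_filter_not univ (fun j => X ≤ 2 * s * x j i) (fun j => x j i)
    rw [← hX, ← hJ] at h2
    have h3 : X + X ≤ 2 * ∑ j ∈ J, x j i + X := by
      calc X + X = 2 * X := by ring
        _ = 2 * ∑ j ∈ J, x j i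
            + 2 * ∑ j ∈ univ.filter (fun j => ¬ X ≤ 2 * s * x j i), x j i := by
            rw [← mul_add, h2]
        _ ≤ _ := by gcongr
    exact le_of_add_le_add_right h3
  have hstep1 : f X ≤ θ'' * f (∑ j ∈ J, x j i) := by
    refine hf.le_of_le_ratio_mul (hXJ.trans (mul_le_mul_left ?_ _))
    calc (2 : ℝ≥0) ≤ 4 * 1 := by norm_num
      _ ≤ _ := by gcongr
  -- the exponents of the values in `J`
  set Z : Finset ℤ := J.image fun j => lg w (x j i) with hZ
  have hXle : ∀ j, x j i ≤ X := fun j => single_le_sum (f := fun j => x j i)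
    (fun _ _ => zero_le) (mem_univ j)
  have hdiff : ∀ a ∈ Z, ∀ b ∈ Z, a ≤ b + N := by
    intro a ha b hb
    obtain ⟨ja, hja, rfl⟩ := mem_image.1 ha
    obtain ⟨jb, hjb, rfl⟩ := mem_image.1 hb
    have h1 := (lg_spec hw1 (hJ0 ja hja)).1
    have h2 := (lg_spec hw1 (hJ0 jb hjb)).2
    have h3 : w ^ lg w (x ja i) < w ^ ((N : ℤ) + (lg w (x jb i) + 1)) := by
      calc w ^ lg w (x ja i) ≤ X := h1.trans (hXle ja)
        _ ≤ 2 * s * x jb i := (mem_filter.1 hjb).2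
        _ < 2 * s * w ^ (lg w (x jb i) + 1) := by gcongr
        _ ≤ w ^ N * w ^ (lg w (x jb i) + 1) := by gcongr
        _ = _ := by rw [zpow_add₀ hw0.ne' (N : ℤ), zpow_natCast]
    have := (zpow_lt_zpow_iff_right₀ hw1).1 h3
    omega
  have hJne : J.Nonempty := by
    rw [nonempty_iff_ne_empty]
    intro h
    rw [h, sum_empty, mul_zero] at hXJ
    exact absurd hXJ (not_le.2 hX0)
  have hZne : Z.Nonempty := hJne.image _
  have hZcard : #Z ≤ N + 1 := by
    have : Z ⊆ Icc (Z.min' hZne) (Z.min' hZne + N) := fun a ha =>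
      mem_Icc.2 ⟨min'_le _ _ ha, hdiff a ha _ (min'_mem _ _)⟩
    refine (card_le_card this).trans ?_
    rw [Int.card_Icc]
    omega
  have hD1 : 1 ≤ D := le_trans (Nat.one_le_pow _ _ (by omega)) hND
  have hZD : #Z ≤ D := by nlinarith
  obtain ⟨z, hzZ, hzmax⟩ := exists_max_image Z
    (fun z => NNReal.sqrt (f (∑ j ∈ J with lg w (x j i) = z, x j i))) hZne
  set J' : Finset (Fin s) := {j ∈ J | lg w (x j i) = z} with hJ'
  -- There are at most N + 1 classes, so the squared sum of roots is at most (N + 1)² ≤ D times the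
  -- largest class, which cancels the division by D.
  have hstep2 : f (∑ j ∈ J, x j i) ≤ cParam f D * f (∑ j ∈ J', x j i) := by
    have h1 := hf.cParam_finset hD1 Z hZD (fun z => ∑ j ∈ J with lg w (x j i) = z, x j i)
    rw [sum_fiberwise_of_maps_to (fun j hj => mem_image_of_mem _ hj)] at h1
    refine h1.trans ?_
    have hD0 : (0 : ℝ≥0) < D := Nat.cast_pos.2 hD1
    have h2 : ∑ z ∈ Z, NNReal.sqrt (f (∑ j ∈ J with lg w (x j i) = z, x j i))
        ≤ (N + 1 : ℕ) * NNReal.sqrt (f (∑ j ∈ J', x j i)) := by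
      refine (sum_le_sum hzmax).trans ?_
      rw [sum_const, nsmul_eq_mul]
      gcongr
    calc cParam f D / D * (∑ z ∈ Z, NNReal.sqrt (f (∑ j ∈ J with lg w (x j i) = z, x j i))) ^ 2
        ≤ cParam f D / D * ((N + 1 : ℕ) * NNReal.sqrt (f (∑ j ∈ J', x j i))) ^ 2 := by gcongr
      _ = cParam f D / D * (((N + 1) ^ 2 : ℕ) * f (∑ j ∈ J', x j i)) := by
          rw [mul_pow, NNReal.sq_sqrt]; push_cast; ring
      _ ≤ cParam f D / D * (D * f (∑ j ∈ J', x j i)) := by gcongr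
      _ = _ := by rw [← mul_assoc, div_mul_cancel₀ _ hD0.ne']
  set r := #J' with hr
  set y := w ^ z with hy
  have hJ'x : ∀ j ∈ J', y ≤ x j i ∧ x j i ≤ w * y := by
    intro j hj
    obtain ⟨h1, h2⟩ := mem_filter.1 hj
    have := lg_spec hw1 (hJ0 j h1)
    rw [h2, zpow_add₀ hw0.ne', zpow_one, mul_comm] at this
    exact ⟨this.1, this.2.le⟩
  have hrs : r ≤ s := (card_le_univ J').trans_eq (Fintype.card_fin s)
  have hstep3 : f (∑ j ∈ J', x j i) ≤ cParam f s / s * (r ^ 2 * (θ'' * f y)) := by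
    refine (hf.cParam_finset hs J' hrs fun j => x j i).trans (mul_le_mul_right ?_ _)
    calc (∑ j ∈ J', NNReal.sqrt (f (x j i))) ^ 2
        ≤ (∑ j ∈ J', NNReal.sqrt (θ'' * f y)) ^ 2 := by
          gcongr with j hj
          refine hf.le_of_le_ratio_mul ((hJ'x j hj).2.trans (mul_le_mul_left ?_ _))
          rw [← hw]
          exact le_mul_of_one_le_left (by positivity) (by norm_num)
      _ = _ := by rw [sum_const, nsmul_eq_mul, mul_pow, NNReal.sq_sqrt]
  have hfX' : f X ≤ θ'' * (cParam f D * f (∑ j ∈ J', x j i)) :=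
    hstep1.trans (mul_le_mul_right hstep2 _)
  have hfJ' : f (∑ j ∈ J', x j i) ≠ 0 := fun h => hfX (by simpa [h] using hfX')
  have hfy : 0 < f y := pos_iff_ne_zero.2 fun h => hfJ' (by simpa [h] using hstep3)
  have hwti : 0 < wt m i := pos_iff_ne_zero.2 fun h => by
    rw [h, mul_zero] at hi; exact absurd hi (not_le.2 hτ)
  have hr1 : 1 ≤ r := by
    by_contra h
    have h0 : J' = ∅ := card_eq_zero.1 (by omega)
    exact hfJ' (by rw [h0, sum_empty]; exact hf.map_zero)
  have hr0 : (0 : ℝ≥0) < r := Nat.cast_pos.2 hr1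
  have hFhy : ∀ j ∈ J', f y * wt m i ≤ Fh j := fun j hj =>
    (mul_le_mul_left (hf.mono (hJ'x j hj).1) _).trans (hFh j i)
  have hFpos : 0 < ∑ j, Fh j := by
    obtain ⟨j, hj⟩ := card_pos.1 (lt_of_lt_of_le zero_lt_one hr1)
    exact (mul_pos hfy hwti).trans_le ((hFhy j hj).trans
      (single_le_sum (f := Fh) (fun _ _ => zero_le) (mem_univ j)))
  have hsub : J'.filter (fun j => r * Fh j ≤ 2 * ∑ j, Fh j) ⊆ grp w x Fh i z r := by
    intro j hj
    obtain ⟨h1, h2⟩ := mem_filter.1 hj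
    obtain ⟨h3, h4⟩ := mem_filter.1 h1
    exact mem_filter.2 ⟨mem_univ _, hJ0 j h3, h4, h2⟩
  -- By averaging, at most half of the r servers have a load exceeding 2/r of the total.
  have hrg : r ≤ 2 * #(grp w x Fh i z r) := by
    have h1 : 2 * #(J'.filter fun j => ¬ r * Fh j ≤ 2 * ∑ j, Fh j) ≤ r := by
      have h2 : (#(J'.filter fun j => ¬ r * Fh j ≤ 2 * ∑ j, Fh j) : ℝ≥0) * (2 * ∑ j, Fh j)
          ≤ r * ∑ j, Fh j := by
        rw [← nsmul_eq_mul, ← sum_const]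
        refine (sum_le_sum fun j hj => (not_le.1 (mem_filter.1 hj).2).le).trans ?_
        rw [← mul_sum]
        exact mul_le_mul_right (sum_le_sum_of_subset (subset_univ _)) _
      rw [← mul_assoc] at h2
      have h3 := le_of_mul_le_mul_right h2 hFpos
      rw [mul_comm] at h3
      exact_mod_cast h3
    have h4 := card_filter_add_card_filter_not (s := J') (fun j => r * Fh j ≤ 2 * ∑ j, Fh j)
    have h5 := card_le_card hsub
    omega
  refine ⟨z, r, hr1, hrs, hrg, ?_, ?_, ?_⟩
  · obtain ⟨j, hj⟩ := card_pos.1 (show 0 < #(grp w x Fh i z r) by omega)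
    obtain ⟨h0, h1, h2⟩ := (mem_filter.1 hj).2
    refine div_le_one_of_le₀ (le_trans ?_ h2) zero_le
    rw [mul_comm]
    refine mul_le_mul_right (le_trans (mul_le_mul_left (hf.mono ?_) _) (hFh j i)) _
    rw [← h1]
    exact (lg_spec hw1 h0).1
  -- Heaviness of i is turned into a lower bound for r² f(y) · wt, which times T/(2 ∑ F_j) is the
  -- expected count T · rate · r.
  · have h1 : τ ≤ θ'' ^ 2 * cParam f D * (cParam f s / s) * (r ^ 2 * f y * wt m i) := by
      calc τ ≤ f X * wt m i := hi
        _ ≤ θ'' * (cParam f D * (cParam f s / s * (r ^ 2 * (θ'' * f y)))) * wt m i := by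
            refine mul_le_mul_left (hfX'.trans ?_) _
            gcongr
        _ = _ := by ring
    have h2 : 8 * Λ * (2 * ∑ j, Fh j) ≤ T * (r ^ 2 * f y * wt m i) := by
      calc 8 * Λ * (2 * ∑ j, Fh j)
          ≤ 8 * Λ * (2 * (2 * (L * (θ'' ^ 2 * cParam f D * (cParam f s / s) *
            (r ^ 2 * f y * wt m i))))) := by
            gcongr
            exact hFsum.trans (by gcongr)
        _ = 32 * Λ * (cParam f s / s) * θ'' ^ 2 * cParam f D * L * (r ^ 2 * f y * wt m i) := by
            ring
        _ ≤ _ := mul_le_mul_left hT _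
    rw [rate, ← mul_div_assoc, div_mul_eq_mul_div, le_div_iff₀ (by positivity)]
    refine h2.trans_eq ?_
    rw [← hy]
    ring
  -- The argument goes from r√θ y to ry/4 to ry/16, each step within a factor 4√θ. The 16 is the
  -- slack of the size test in `GoodSamples.sound`.
  · have h1 : f (∑ j ∈ J', x j i) ≤ θ'' * (θ'' * f (y * r / 16)) := by
      have hle : ∑ j ∈ J', x j i ≤ r * (w * y) := by
        refine (sum_le_sum fun j hj => (hJ'x j hj).2).trans_eq ?_
        rw [sum_const, nsmul_eq_mul]
      refine (hf.le_of_le_ratio_mul (z := y * r / 4) ?_).trans (mul_le_mul_right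
        (hf.le_of_le_ratio_mul ?_) _)
      · refine hle.trans_eq ?_
        rw [← hw]
        rw [mul_div_assoc', eq_div_iff (by norm_num)]
        ring
      · rw [← hw, mul_div_assoc', div_le_div_iff₀ (by norm_num) (by norm_num)]
        calc y * r * 16 = 1 * (y * r * 16) := by ring
          _ ≤ w * (y * r * 16) := by gcongr
          _ = _ := by ring
    calc f X * wt m i ≤ θ'' * (cParam f D * (θ'' * (θ'' * f (y * r / 16)))) * wt m i := by
          refine mul_le_mul_left (hfX'.trans ?_) _
          gcongr
      _ = _ := by rw [score]; ring

variable [Fintype ι]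

/-- The coordinates whose weighted value is witnessed to be at least `q`. -/
def passSet (f : ℝ≥0 → ℝ≥0) (w Λ : ℝ≥0) (m : ι → Fin M) (u : ι × Fin s × Fin T → Fin M')
    (x : Fin s → ι → ℝ≥0) (Fh : Fin s → ℝ≥0) (q : ℝ≥0) : Finset ι :=
  {i | ∃ z r, Pass f w Λ m u x Fh i z r ∧ q ≤ score f w m i z r}

/-- At most `K` coordinates, those of the largest witnessed weighted values. -/
def cand (f : ℝ≥0 → ℝ≥0) (w Λ : ℝ≥0) (m : ι → Fin M) (u : ι × Fin s × Fin T → Fin M') (K : ℕ)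
    (x : Fin s → ι → ℝ≥0) (Fh : Fin s → ℝ≥0) : Finset ι :=
  {i | ∃ q, i ∈ passSet f w Λ m u x Fh q ∧ #(passSet f w Λ m u x Fh q) ≤ K}

/-- The coordinates that the server `j` samples. -/
def samp (f : ℝ≥0 → ℝ≥0) (m : ι → Fin M) (u : ι × Fin s × Fin T → Fin M')
    (xj : ι → ℝ≥0) (Fj : ℝ≥0) (j : Fin s) : Finset ι :=
  {i | ∃ l, ((u (i, j, l) : ℕ) : ℝ) + 1 ≤ M' * ((f (xj i) * wt m i / Fj : ℝ≥0) : ℝ)}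

/-- The sets `passSet` shrink as q grows, so the one for the smallest q among all candidates
contains every candidate. -/
theorem card_cand_le (f : ℝ≥0 → ℝ≥0) (w Λ : ℝ≥0) (m : ι → Fin M) (u : ι × Fin s × Fin T → Fin M')
    (K : ℕ) (x : Fin s → ι → ℝ≥0) (Fh : Fin s → ℝ≥0) : #(cand f w Λ m u K x Fh) ≤ K := by
  rcases (cand f w Λ m u K x Fh).eq_empty_or_nonempty with h | h
  · simp [h]
  · have hc : ∀ i ∈ cand f w Λ m u K x Fh, ∃ q, i ∈ passSet f w Λ m u x Fh q ∧
        #(passSet f w Λ m u x Fh q) ≤ K := fun i hi => (mem_filter.1 hi).2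
    choose! q hq using hc
    obtain ⟨i0, hi0, hmin⟩ := exists_min_image _ q h
    refine (card_le_card fun i hi => ?_).trans (hq i0 hi0).2
    obtain ⟨z, r, hp, hle⟩ := (mem_filter.1 (hq i hi).1).2
    exact mem_filter.2 ⟨mem_univ _, z, r, hp, (hmin i hi).trans hle⟩

/-- The event that the samples find all coordinates of weighted value at least `τ`. -/
structure GoodSamples (f : ℝ≥0 → ℝ≥0) (w Λ : ℝ≥0) (m : ι → Fin M) (x : Fin s → ι → ℝ≥0)
    (Fh : Fin s → ℝ≥0) (α τ : ℝ≥0) (u : ι × Fin s × Fin T → Fin M') : Prop where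
  sound : ∀ i z r, Pass f w Λ m u x Fh i z r → r ≤ 16 * #(grp w x Fh i z r)
  complete : ∀ i, τ ≤ f (∑ j, x j i) * wt m i → ∃ z r, Pass f w Λ m u x Fh i z r ∧
    f (∑ j, x j i) * wt m i ≤ α * score f w m i z r
  short : ∀ j, #(samp f m u (x j) (Fh j) j) ≤ 4 * T

/-- In each of the T trials the sampling probabilities sum to at most 1, so T hits are expected at
most; then the upper tail at 4T. -/
theorem pr_samp_le (f : ℝ≥0 → ℝ≥0) (m : ι → Fin M) (xj : ι → ℝ≥0) (Fj : ℝ≥0) (j : Fin s)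
    (hM' : 0 < M') (hF : ∑ i, f (xj i) * wt m i ≤ Fj) :
    pr (fun u : ι × Fin s × Fin T → Fin M' => ¬ #(samp f m u xj Fj j) ≤ 4 * T)
      ≤ Real.exp (-T) := by
  set p : ι × Fin s × Fin T → ℝ := fun k => M' * ((f (xj k.1) * wt m k.1 / Fj : ℝ≥0) : ℝ) with hp
  set S : Finset (ι × Fin s × Fin T) := univ ×ˢ ({j} ×ˢ univ) with hS
  have hM0 : (0 : ℝ) < M' := Nat.cast_pos.2 hM'
  have hμ : ∑ k ∈ S, avg (fun a : Fin M' => if ((a : ℕ) : ℝ) + 1 ≤ p k then (1 : ℝ) else 0)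
      ≤ (T : ℝ) := by
    calc _ ≤ ∑ k ∈ S, ((f (xj k.1) * wt m k.1 / Fj : ℝ≥0) : ℝ) := by
          refine sum_le_sum fun k _ => (avg_hit_le _ (by positivity)).trans_eq ?_
          rw [hp]; simp only; rw [mul_div_cancel_left₀ _ hM0.ne']
      _ = T * ((∑ i, f (xj i) * wt m i) / Fj : ℝ≥0) := by
          rw [hS, sum_product]
          simp only [sum_const, card_product, card_singleton, card_univ, Fintype.card_fin, one_mul,
            nsmul_eq_mul]
          rw [← mul_sum, sum_div]
          push_cast
          rfl
      _ ≤ T * ((1 : ℝ≥0) : ℝ) := by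
          gcongr
          exact div_le_one_of_le₀ hF zero_le
      _ = T := by simp
  have h1 := pr_hits_ge_le (a := 4 * T) hM' S p hμ
  have h2 : Real.exp (T - 4 * T * Real.log 2) ≤ Real.exp (-T) := by
    refine Real.exp_le_exp.2 ?_
    have := Real.log_two_gt_d9
    nlinarith [Nat.cast_nonneg (α := ℝ) T]
  refine le_trans (pr_mono fun u hu => ?_) (h1.trans h2)
  have h3 : #(samp f m u xj Fj j) ≤ hits S p u := by
    calc #(samp f m u xj Fj j)
        ≤ #((S.filter fun k => ((u k : ℕ) : ℝ) + 1 ≤ p k).image Prod.fst) := by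
          refine card_le_card fun i hi => ?_
          obtain ⟨l, hl⟩ := (mem_filter.1 hi).2
          exact mem_image.2 ⟨(i, j, l), mem_filter.2 ⟨by simp [hS], hl⟩, rfl⟩
      _ ≤ _ := card_image_le
  have h4 : 4 * T ≤ hits S p u := (not_le.1 hu).le.trans h3
  exact_mod_cast h4

/-- A group smaller than r/16 has mean count at most a = T · rate · r/16, but passing needs 2a hits.
The tail exponent is a(1 - 2 log 2) with a ≥ Λ/2, whence 19/100. -/
theorem pr_not_sound_le (f : ℝ≥0 → ℝ≥0) (w Λ : ℝ≥0) (m : ι → Fin M) (x : Fin s → ι → ℝ≥0)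
    (Fh : Fin s → ℝ≥0) (i : ι) (z : ℤ) (r : ℕ) (hM' : 0 < M') :
    pr (fun u : ι × Fin s × Fin T → Fin M' => Pass f w Λ m u x Fh i z r ∧
      ¬ r ≤ 16 * #(grp w x Fh i z r)) ≤ Real.exp (-(19 / 100 * Λ)) := by
  set a : ℝ := T * rate f w m Fh i z r * r / 16 with ha
  by_cases h : r ≤ 16 * #(grp w x Fh i z r)
  · simp only [h, not_true_eq_false, and_false, pr_false]
    positivity
  by_cases h2 : 8 * Λ ≤ T * rate f w m Fh i z r * r
  · have h2' : 8 * (Λ : ℝ) ≤ T * rate f w m Fh i z r * r := by exact_mod_cast h2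
    have hμ := (cnt_mean_le (T := T) f w m x Fh i z r hM').trans (b := _) (c := a) (by
      have : (16 : ℝ) * #(grp w x Fh i z r) ≤ r := by exact_mod_cast (not_le.1 h).le
      have h0 : (0 : ℝ) ≤ T * rate f w m Fh i z r := by positivity
      rw [ha, le_div_iff₀ (by norm_num)]
      nlinarith)
    refine le_trans (pr_mono fun u hu => ?_)
      ((pr_hits_ge_le (a := 2 * a) hM' _ _ hμ).trans (Real.exp_le_exp.2 ?_))
    · have := hu.1.2.2.2.2
      have h3 : (T : ℝ) * rate f w m Fh i z r * r ≤ 8 * (cnt f w m u x Fh i z r : ℝ) := by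
        exact_mod_cast this
      change 2 * a ≤ (cnt f w m u x Fh i z r : ℝ)
      rw [ha]
      linarith
    · have := Real.log_two_gt_d9
      nlinarith [Λ.2, show (Λ : ℝ) / 2 ≤ a by rw [ha]; linarith]
  · refine le_trans (pr_mono (q := fun _ => False) fun u hu => h2 hu.1.2.2.2.1) ?_
    rw [pr_false]
    positivity

/-- The mean count is at least T · rate · r/4, twice what passing needs: one factor 1/2 is lost in
the group size, one in discretising the sampling probability. The latter uses M' · rate ≥ 1, which
follows from T · s ≤ M'. -/
theorem pr_not_pass_le (f : ℝ≥0 → ℝ≥0) (w Λ : ℝ≥0) (m : ι → Fin M) (x : Fin s → ι → ℝ≥0)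
    (Fh : Fin s → ℝ≥0) (i : ι) (z : ℤ) (r : ℕ) (hT : T * s ≤ M') (hΛ : 1 ≤ Λ) (hr : 1 ≤ r)
    (hrs : r ≤ s) (hrg : r ≤ 2 * #(grp w x Fh i z r)) (hδ : rate f w m Fh i z r ≤ 1)
    (hμ : 8 * Λ ≤ T * rate f w m Fh i z r * r) :
    pr (fun u : ι × Fin s × Fin T → Fin M' => ¬ Pass f w Λ m u x Fh i z r)
      ≤ Real.exp (-(19 / 100 * Λ)) := by
  obtain ⟨δ, hδd⟩ : ∃ δ : ℝ, δ = (rate f w m Fh i z r : ℝ) := ⟨_, rfl⟩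
  have hδ0 : 0 ≤ δ := hδd ▸ NNReal.coe_nonneg _
  have hΛ' : (1 : ℝ) ≤ Λ := by exact_mod_cast hΛ
  have hμ' : 8 * (Λ : ℝ) ≤ T * δ * r := by rw [hδd]; exact_mod_cast hμ
  have hδ' : δ ≤ 1 := by rw [hδd]; exact_mod_cast hδ
  have hr' : (r : ℝ) ≤ s := by exact_mod_cast hrs
  have hMδ : 1 ≤ M' * δ := by
    have h1 : (T : ℝ) * s ≤ M' := by exact_mod_cast hT
    have h2 : (T : ℝ) * δ * r ≤ T * δ * s := by gcongr
    nlinarith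
  have hM' : 0 < M' := by
    rcases Nat.eq_zero_or_pos M' with h | h
    · rw [h] at hMδ; norm_num at hMδ
    · exact h
  have hM0 : (0 : ℝ) < M' := Nat.cast_pos.2 hM'
  have hlow : (T : ℝ) * δ * r / 4 ≤
      ∑ _k ∈ ({i} ×ˢ (grp w x Fh i z r ×ˢ univ) : Finset (ι × Fin s × Fin T)),
      avg (fun a : Fin M' => if ((a : ℕ) : ℝ) + 1 ≤ M' * δ then (1 : ℝ) else 0) := by
    have h3 := le_avg_hit hMδ (by nlinarith : M' * δ ≤ M')
    have h4 : M' * δ / (2 * M') = δ / 2 := by field_simp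
    rw [h4] at h3
    rw [sum_const, card_product, card_product, card_singleton, one_mul, card_univ,
      Fintype.card_fin, nsmul_eq_mul]
    push_cast
    calc (T : ℝ) * δ * r / 4 = r / 2 * (T * (δ / 2)) := by ring
      _ ≤ #(grp w x Fh i z r) * (T * (δ / 2)) := by
          gcongr
          have : (r : ℝ) ≤ 2 * #(grp w x Fh i z r) := by exact_mod_cast hrg
          linarith
      _ = #(grp w x Fh i z r) * T * (δ / 2) := by ring
      _ ≤ _ := by gcongr
  refine le_trans (pr_mono fun u hu => ?_)
    ((pr_hits_le_le (a := T * δ * r / 8) hM' _ _ hlow).trans (Real.exp_le_exp.2 ?_))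
  · by_contra hcon
    have h5 : (T : ℝ) * δ * r / 8 ≤ (cnt f w m u x Fh i z r : ℝ) := by
      rw [cnt, ← hδd]
      exact (not_le.1 hcon).le
    refine hu ⟨hr, hrs, hδ, hμ, ?_⟩
    rw [← NNReal.coe_le_coe]
    push_cast
    rw [← hδd]
    linarith
  · have := Real.log_two_lt_d9
    nlinarith

/-- Take the level q = τ/α. By soundness every coordinate passing at this level really has weighted
value at least τ/α, and the total is at most Lτ, so at most αL ≤ K of them pass. -/
theorem subset_cand {f : ℝ≥0 → ℝ≥0} {θ θ' θ'' : ℝ≥0} (hf : ApproxInvertible f θ θ' θ'')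
    {w Λ : ℝ≥0} (hw : 1 < w) {m : ι → Fin M} {x : Fin s → ι → ℝ≥0} {Fh : Fin s → ℝ≥0}
    {α τ L : ℝ≥0} {u : ι × Fin s × Fin T → Fin M'} (hu : GoodSamples f w Λ m x Fh α τ u)
    (hα : 0 < α) (hτ : 0 < τ) (hL : ∑ i, f (∑ j, x j i) * wt m i ≤ L * τ) {K : ℕ}
    (hK : α * L ≤ K) {i : ι} (hi : τ ≤ f (∑ j, x j i) * wt m i) :
    i ∈ cand f w Λ m u K x Fh := by
  obtain ⟨z, r, hp, hs⟩ := hu.complete i hi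
  refine mem_filter.2 ⟨mem_univ _, τ / α, mem_filter.2 ⟨mem_univ _, z, r, hp, ?_⟩, ?_⟩
  · rw [div_le_iff₀' hα]
    exact hi.trans hs
  · have h1 : ∀ k ∈ passSet f w Λ m u x Fh (τ / α), τ / α ≤ f (∑ j, x j k) * wt m k := by
      intro k hk
      obtain ⟨z, r, hp, hq⟩ := (mem_filter.1 hk).2
      refine hq.trans (mul_le_mul_left (hf.mono ?_) _)
      rw [div_le_iff₀ (by norm_num)]
      calc w ^ z * r ≤ w ^ z * (16 * #(grp w x Fh k z r) : ℕ) := by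
            gcongr
            exact hu.sound k z r hp
        _ = w ^ z * #(grp w x Fh k z r) * 16 := by push_cast; ring
        _ ≤ _ := mul_le_mul_left (sum_grp_le hw x Fh k z r) _
    have h2 : (#(passSet f w Λ m u x Fh (τ / α)) : ℝ≥0) * (τ / α) ≤ L * τ := by
      calc _ = ∑ k ∈ passSet f w Λ m u x Fh (τ / α), τ / α := by
            rw [sum_const, nsmul_eq_mul]
        _ ≤ ∑ k ∈ passSet f w Λ m u x Fh (τ / α), f (∑ j, x j k) * wt m k := sum_le_sum h1
        _ ≤ _ := (sum_le_sum_of_subset (subset_univ _)).trans hL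
    have h3 : (#(passSet f w Λ m u x Fh (τ / α)) : ℝ≥0) ≤ α * L := by
      rw [← mul_div_assoc, div_le_iff₀ hα] at h2
      refine le_of_mul_le_mul_right (h2.trans_eq ?_) hτ
      ring
    exact_mod_cast h3.trans hK

theorem pr_not_goodSamples_le {f : ℝ≥0 → ℝ≥0} {θ θ' θ'' : ℝ≥0} (hf : ApproxInvertible f θ θ' θ'')
    {Λ : ℝ≥0} {m : ι → Fin M} {x : Fin s → ι → ℝ≥0} {Fh : Fin s → ℝ≥0} {τ L : ℝ≥0} {D N : ℕ}
    (hs : 1 ≤ s) (hN : 2 * (s : ℝ≥0) ≤ NNReal.sqrt θ ^ N) (hND : (N + 1) ^ 2 ≤ D)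
    (hFh : ∀ j, ∑ i, f (x j i) * wt m i ≤ Fh j) (hFsum : ∑ j, Fh j ≤ 2 * (L * τ)) (hτ : 0 < τ)
    (hΛ : 1 ≤ Λ) (hTΛ : Λ ≤ T)
    (hT : 32 * Λ * (cParam f s / s) * θ'' ^ 2 * cParam f D * L ≤ T) (hM' : T * s ≤ M') :
    pr (fun u : ι × Fin s × Fin T → Fin M' => ¬ GoodSamples f (NNReal.sqrt θ) Λ m x Fh
      (θ'' ^ 3 * cParam f D) τ u)
      ≤ (Fintype.card ι * s ^ 2 + Fintype.card ι + s) * Real.exp (-(19 / 100 * Λ)) := by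
  set w := NNReal.sqrt θ with hw
  set b := Real.exp (-(19 / 100 * Λ)) with hb
  have hT1 : 1 ≤ T := by exact_mod_cast hΛ.trans hTΛ
  have hM0 : 0 < M' := lt_of_lt_of_le (Nat.mul_pos hT1 hs) hM'
  have hFh' : ∀ j i, f (x j i) * wt m i ≤ Fh j := fun j i =>
    (single_le_sum (f := fun i => f (x j i) * wt m i) (fun _ _ => zero_le) (mem_univ i)).trans
      (hFh j)
  have hex : ∀ i, ∃ z r, τ ≤ f (∑ j, x j i) * wt m i → 1 ≤ r ∧ r ≤ s ∧
      r ≤ 2 * #(grp w x Fh i z r) ∧ rate f w m Fh i z r ≤ 1 ∧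
      8 * Λ ≤ T * rate f w m Fh i z r * r ∧
      f (∑ j, x j i) * wt m i ≤ θ'' ^ 3 * cParam f D * score f w m i z r := by
    intro i
    by_cases hi : τ ≤ f (∑ j, x j i) * wt m i
    · obtain ⟨z, r, h⟩ := exists_grp hf hs hN hND hFh' hFsum hτ hT hi
      exact ⟨z, r, fun _ => h⟩
    · exact ⟨0, 0, fun h => absurd h hi⟩
  choose z r hzr using hex
  -- Soundness concerns all z ∈ ℤ, but a passing group has a hit, hence a member, so only the
  -- exponents of the servers' own values enter the union bound. The size r ∈ {1, …, s} is coded as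
  -- `a.2.2 + 1`.
  refine le_trans (pr_mono (q := fun u : ι × Fin s × Fin T → Fin M' =>
      ((∃ a ∈ (univ : Finset (ι × Fin s × Fin s)),
        Pass f w Λ m u x Fh a.1 (lg w (x a.2.1 a.1)) (a.2.2 + 1) ∧
        ¬ (a.2.2 + 1 : ℕ) ≤ 16 * #(grp w x Fh a.1 (lg w (x a.2.1 a.1)) (a.2.2 + 1))) ∨
      (∃ i ∈ (univ : Finset ι), τ ≤ f (∑ j, x j i) * wt m i ∧
        ¬ Pass f w Λ m u x Fh i (z i) (r i))) ∨
      (∃ j ∈ (univ : Finset (Fin s)), ¬ #(samp f m u (x j) (Fh j) j) ≤ 4 * T)) ?_)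
    ((pr_or_le _ _).trans ((add_le_add ((pr_or_le _ _).trans (add_le_add
      ((pr_exists_le _ _).trans (sum_le_card_nsmul _ _ b ?_))
      ((pr_exists_le _ _).trans (sum_le_card_nsmul _ _ b ?_))))
      ((pr_exists_le _ _).trans (sum_le_card_nsmul _ _ b ?_))).trans_eq ?_))
  · intro u hu
    by_contra hcon
    push Not at hcon
    obtain ⟨⟨h1, h2⟩, h3⟩ := hcon
    refine hu ⟨?_, ?_, fun j => h3 j (mem_univ j)⟩
    · intro i z r hp
      obtain ⟨hr1, hrs, -, h8, hc⟩ := id hp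
      have hcnt : 0 < cnt f w m u x Fh i z r := by
        by_contra h
        have h0 : cnt f w m u x Fh i z r = 0 := by omega
        rw [h0] at hc
        have := h8.trans hc
        simp only [Nat.cast_zero, mul_zero] at this
        have : Λ = 0 := by simpa using this
        rw [this] at hΛ
        exact absurd hΛ (by norm_num)
      have hgrp : (grp w x Fh i z r).Nonempty := by
        obtain ⟨k, hk⟩ := card_pos.1 hcnt
        have := (mem_filter.1 hk).1
        simp only [mem_product] at this
        exact ⟨_, this.2.1⟩
      obtain ⟨j, hj⟩ := hgrp
      obtain ⟨-, hz, -⟩ := (mem_filter.1 hj).2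
      obtain ⟨r', rfl⟩ : ∃ r', r = r' + 1 := ⟨r - 1, by omega⟩
      have := h1 (i, j, ⟨r', by omega⟩) (mem_univ _)
      simp only [hz] at this
      exact this hp
    · intro i hi
      exact ⟨z i, r i, h2 i (mem_univ i) hi, (hzr i hi).2.2.2.2.2⟩
  · intro a _
    exact pr_not_sound_le f w Λ m x Fh _ _ _ hM0
  · intro i _
    by_cases hi : τ ≤ f (∑ j, x j i) * wt m i
    · obtain ⟨h1, h2, h3, h4, h5, -⟩ := hzr i hi
      refine (pr_mono fun u hu => hu.2).trans
        (pr_not_pass_le f w Λ m x Fh i (z i) (r i) hM' hΛ h1 h2 h3 h4 h5)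
    · refine (pr_mono (q := fun _ => False) fun u hu => hi hu.1).trans ?_
      rw [pr_false]
      positivity
  · intro j _
    refine (pr_samp_le f m (x j) (Fh j) j hM0 (hFh j)).trans (Real.exp_le_exp.2 ?_)
    have : (Λ : ℝ) ≤ T := by exact_mod_cast hTΛ
    have h0 : (0 : ℝ) ≤ Λ := Λ.2
    linarith
  · simp only [card_univ, Fintype.card_prod, Fintype.card_fin, nsmul_eq_mul]
    push_cast
    ring

end FiniteProb

namespace FiniteProb

open Finset
open scoped Classical

/-! ### Describing the load of a server by its maximum and an integer. -/

section Report

variable {ι : Type*} [Fintype ι] {M : ℕ}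

/-- The largest weighted value of a server. -/
def vmax (f : ℝ≥0 → ℝ≥0) (m : ι → Fin M) (xj : ι → ℝ≥0) : ℝ≥0 :=
  univ.sup fun i => f (xj i) * wt m i

/-- The rounded ratio of the sum and the maximum of the weighted values of a server. -/
def ratio (f : ℝ≥0 → ℝ≥0) (m : ι → Fin M) (xj : ι → ℝ≥0) : ℕ :=
  ⌈(∑ i, f (xj i) * wt m i) / vmax f m xj⌉₊ - 1

/-- The sum of the weighted values of a server, up to a factor of two. -/
def load (f : ℝ≥0 → ℝ≥0) (m : ι → Fin M) (xj : ι → ℝ≥0) : ℝ≥0 :=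
  (ratio f m xj + 1) * vmax f m xj

theorem le_vmax (f : ℝ≥0 → ℝ≥0) (m : ι → Fin M) (xj : ι → ℝ≥0) (i : ι) :
    f (xj i) * wt m i ≤ vmax f m xj :=
  le_sup (f := fun i => f (xj i) * wt m i) (mem_univ i)

theorem vmax_le_sum (f : ℝ≥0 → ℝ≥0) (m : ι → Fin M) (xj : ι → ℝ≥0) :
    vmax f m xj ≤ ∑ i, f (xj i) * wt m i :=
  Finset.sup_le fun i _ =>
    single_le_sum (f := fun i => f (xj i) * wt m i) (fun _ _ => zero_le) (mem_univ i)

theorem sum_le_card_mul_vmax (f : ℝ≥0 → ℝ≥0) (m : ι → Fin M) (xj : ι → ℝ≥0) :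
    ∑ i, f (xj i) * wt m i ≤ Fintype.card ι * vmax f m xj := by
  refine (sum_le_sum fun i _ => le_vmax f m xj i).trans_eq ?_
  simp

/-- The subtraction of one in `ratio` matters here: the rounded quotient may equal the number of
coordinates, which need not fit into one word. -/
theorem ratio_lt (f : ℝ≥0 → ℝ≥0) (m : ι → Fin M) (xj : ι → ℝ≥0) {n : ℕ} (hn : 0 < n)
    (hc : Fintype.card ι ≤ n) : ratio f m xj < n := by
  have : ⌈(∑ i, f (xj i) * wt m i) / vmax f m xj⌉₊ ≤ Fintype.card ι :=
    Nat.ceil_le.2 (div_le_of_le_mul₀ zero_le zero_le (sum_le_card_mul_vmax f m xj))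
  unfold ratio
  omega

theorem load_bounds (f : ℝ≥0 → ℝ≥0) (m : ι → Fin M) (xj : ι → ℝ≥0) :
    ∑ i, f (xj i) * wt m i ≤ load f m xj ∧ load f m xj ≤ 2 * ∑ i, f (xj i) * wt m i := by
  rcases eq_or_ne (vmax f m xj) 0 with h | h
  · have := sum_le_card_mul_vmax f m xj
    rw [h, mul_zero] at this
    simp only [load, h, mul_zero]
    exact ⟨this, zero_le⟩
  · have hpos : 0 < vmax f m xj := pos_iff_ne_zero.2 h
    set t := (∑ i, f (xj i) * wt m i) / vmax f m xj with ht
    have ht1 : 1 ≤ t := (one_le_div hpos).2 (vmax_le_sum f m xj)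
    have hsum : ∑ i, f (xj i) * wt m i = t * vmax f m xj := (div_mul_cancel₀ _ h).symm
    have hc : 1 ≤ ⌈t⌉₊ := Nat.one_le_ceil_iff.2 (zero_lt_one.trans_le ht1)
    have hr : ((ratio f m xj : ℕ) : ℝ≥0) + 1 = ⌈t⌉₊ := by
      rw [ratio, ← ht]
      exact_mod_cast Nat.sub_add_cancel hc
    rw [load, hr, hsum, ← mul_assoc]
    refine ⟨mul_le_mul_left (Nat.le_ceil t) _, mul_le_mul_left ?_ _⟩
    refine (Nat.ceil_lt_add_one zero_le).le.trans ?_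
    rw [two_mul]
    gcongr

end Report

/-! ### Messages as lists of named values. -/

section Encoding

variable {ι : Type*} {b : ℕ}

/-- A string of `b` bits as a number. -/
def numOf (c : Fin b → Bool) : ℕ := Fintype.equivFin (Fin b → Bool) c

/-- The string of `b` bits of a number below `2 ^ b`. -/
def ofNum (e : ℕ) : Fin b → Bool :=
  if h : e < Fintype.card (Fin b → Bool) then (Fintype.equivFin _).symm ⟨e, h⟩ else fun _ => false

theorem numOf_ofNum {e : ℕ} (h : e < 2 ^ b) : numOf (ofNum e : Fin b → Bool) = e := by
  have h' : e < Fintype.card (Fin b → Bool) := by simpa using h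
  rw [ofNum, dif_pos h', numOf, Equiv.apply_symm_apply]

/-- The message listing the values of `x` at the indices in `l`. -/
def encodeList (enc : ι ↪ (Fin b → Bool)) (x : ι → ℝ≥0) (l : List ι) : List (Word b) :=
  l.flatMap fun i => [Word.bits (enc i), Word.value (x i)]

/-- The value listed under the name `c` in a message. -/
def lookup (c : Fin b → Bool) : List (Word b) → ℝ≥0
  | Word.bits c' :: Word.value x :: l => if c' = c then x else lookup c l
  | _ => 0

/-- The number at the head of a message. -/
def headNum : List (Word b) → ℕ
  | Word.bits c :: _ => numOf c
  | _ => 0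

theorem lookup_encodeList (enc : ι ↪ (Fin b → Bool)) (x : ι → ℝ≥0) (l : List ι) (i : ι) :
    lookup (enc i) (encodeList enc x l) = if i ∈ l then x i else 0 := by
  induction l with
  | nil => simp [encodeList, lookup]
  | cons a l ih =>
    have : encodeList enc x (a :: l)
        = Word.bits (enc a) :: Word.value (x a) :: encodeList enc x l := rfl
    rw [this, lookup, ih]
    by_cases h : a = i
    · subst h; simp
    · have h' : i ≠ a := fun h0 => h h0.symm
      simp [h, h']

theorem length_encodeList (enc : ι ↪ (Fin b → Bool)) (x : ι → ℝ≥0) (l : List ι) :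
    (encodeList enc x l).length = 2 * l.length := by
  induction l with
  | nil => rfl
  | cons a l ih =>
    have : encodeList enc x (a :: l)
        = Word.bits (enc a) :: Word.value (x a) :: encodeList enc x l := rfl
    rw [this, List.length_cons, List.length_cons, ih, List.length_cons]
    ring

theorem value_mem_encodeList {enc : ι ↪ (Fin b → Bool)} {x : ι → ℝ≥0} {l : List ι} {y : ℝ≥0}
    (h : Word.value y ∈ encodeList enc x l) : y ∈ Set.range x := by
  obtain ⟨i, -, hi⟩ := List.mem_flatMap.1 h
  simp only [List.mem_cons, List.not_mem_nil, or_false, reduceCtorEq, false_or,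
    Word.value.injEq] at hi
  exact ⟨i, hi.symm⟩

end Encoding

/-! ### Sampled values suffice to determine the candidates. -/

section Congr

variable {ι : Type*} [Fintype ι] {s T M M' : ℕ}

/-- The coordinator finds the same candidates from the sampled values as from all values. -/
theorem cand_congr {f : ℝ≥0 → ℝ≥0} {θ θ' θ'' : ℝ≥0} (hf : ApproxInvertible f θ θ' θ'')
    {w : ℝ≥0} (hw : 1 < w) (Λ : ℝ≥0) (m : ι → Fin M) (u : ι × Fin s × Fin T → Fin M') (K : ℕ)
    {x y : Fin s → ι → ℝ≥0} {Fh : Fin s → ℝ≥0} (hy : ∀ j i, y j i = x j i ∨ y j i = 0)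
    (hsamp : ∀ j, ∀ i ∈ samp f m u (x j) (Fh j) j, y j i = x j i)
    (hFh : ∀ j i, f (x j i) * wt m i ≤ Fh j) :
    cand f w Λ m u K y Fh = cand f w Λ m u K x Fh := by
  have hcnt : ∀ i z r, cnt f w m u y Fh i z r = cnt f w m u x Fh i z r := by
    intro i z r
    unfold cnt hits
    congr 1
    ext ⟨i', j, l⟩
    simp only [mem_filter, mem_product, mem_singleton, mem_univ, and_true]
    refine and_congr_left fun hu => and_congr_right fun hi => ?_
    subst hi
    simp only [grp, mem_filter, mem_univ, true_and]
    constructor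
    · rintro ⟨h0, h1, h2⟩
      rcases hy j i' with h | h
      · rw [h] at h0 h1; exact ⟨h0, h1, h2⟩
      · exact absurd h h0
    · rintro ⟨h0, h1, h2⟩
      -- The load condition in `grp` makes the common rate at most the server's own sampling rate,
      -- so every hit counted for the group was sampled by the server.
      have hmem : i' ∈ samp f m u (x j) (Fh j) j := by
        refine mem_filter.2 ⟨mem_univ _, l, hu.trans ?_⟩
        refine mul_le_mul_of_nonneg_left (NNReal.coe_le_coe.2 ?_) (Nat.cast_nonneg _)
        have hle : f (w ^ z) ≤ f (x j i') := hf.mono (h1 ▸ (lg_spec hw h0).1)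
        have hpos : 0 < Fh j := by
          refine pos_iff_ne_zero.2 fun hF => ?_
          have h3 : f (w ^ z) * wt m i' = 0 := nonpos_iff_eq_zero.1
            (((mul_le_mul_left hle _).trans (hFh j i')).trans_eq hF)
          rw [rate, h3] at hu
          simp only [zero_mul, zero_div, NNReal.coe_zero, mul_zero] at hu
          have : (0 : ℝ) ≤ ((u (i', j, l) : ℕ) : ℝ) := Nat.cast_nonneg _
          linarith
        have hsum : 0 < ∑ j, Fh j :=
          hpos.trans_le (single_le_sum (f := Fh) (fun _ _ => zero_le) (mem_univ j))
        rw [rate, div_le_div_iff₀ (by positivity) hpos]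
        calc f (w ^ z) * wt m i' * r * Fh j = f (w ^ z) * wt m i' * (r * Fh j) := by ring
          _ ≤ f (x j i') * wt m i' * (2 * ∑ j, Fh j) := by gcongr
      rw [hsamp j i' hmem]
      exact ⟨h0, h1, h2⟩
  have hset : ∀ q, passSet f w Λ m u y Fh q = passSet f w Λ m u x Fh q := by
    intro q
    unfold passSet Pass
    simp only [hcnt]
  unfold cand
  simp only [hset]

end Congr

/-! ### The protocol, its cost and its correctness. -/

section Protocol

variable {n k s b : ℕ} {T M M' : ℕ}

/-- The randomness of the protocol: the weights of the coordinates, and the samples. -/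
abbrev Coins (k n s T M M' : ℕ) : Type :=
  ((Fin k ↪ Fin n) → Fin M) × ((Fin k ↪ Fin n) × Fin s × Fin T → Fin M')

/-- The coordinates that the server `j` reports: the largest one, and its samples. -/
def report (f : ℝ≥0 → ℝ≥0) (ω : Coins k n s T M M') (xj : (Fin k ↪ Fin n) → ℝ≥0) (j : Fin s) :
    List (Fin k ↪ Fin n) :=
  (univ.filter fun i => f (xj i) * wt ω.1 i = vmax f ω.1 xj).toList.take 1 ++
    (samp f ω.1 ω.2 xj (load f ω.1 xj) j).toList.take (4 * T)

/-- The first message of a server. -/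
def firstMsg (f : ℝ≥0 → ℝ≥0) (enc : (Fin k ↪ Fin n) ↪ (Fin b → Bool)) (ω : Coins k n s T M M')
    (xj : (Fin k ↪ Fin n) → ℝ≥0) (j : Fin s) : List (Word b) :=
  Word.bits (ofNum (ratio f ω.1 xj)) :: encodeList enc xj (report f ω xj j)

/-- The reported values. -/
def seen (enc : (Fin k ↪ Fin n) ↪ (Fin b → Bool)) (c : Fin s → List (Word b)) (j : Fin s)
    (i : Fin k ↪ Fin n) : ℝ≥0 :=
  lookup (enc i) (c j).tail

/-- The reported sums of weighted values. -/
def seenLoad (f : ℝ≥0 → ℝ≥0) (enc : (Fin k ↪ Fin n) ↪ (Fin b → Bool)) (ω : Coins k n s T M M')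
    (c : Fin s → List (Word b)) (j : Fin s) : ℝ≥0 :=
  (headNum (c j) + 1) * vmax f ω.1 (seen enc c j)

/-- The coordinates about which the coordinator asks. -/
def asked (f : ℝ≥0 → ℝ≥0) (w Λ : ℝ≥0) (K : ℕ) (enc : (Fin k ↪ Fin n) ↪ (Fin b → Bool))
    (ω : Coins k n s T M M') (c : Fin s → List (Word b)) : Finset (Fin k ↪ Fin n) :=
  cand f w Λ ω.1 ω.2 K (seen enc c) (seenLoad f enc ω c)

/-- The output for the set `R` of coordinates with the values `a`. -/
def outVal (ε : ℝ≥0) (m : (Fin k ↪ Fin n) → Fin M) (R : Finset (Fin k ↪ Fin n))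
    (a : (Fin k ↪ Fin n) → ℝ≥0) : ℝ :=
  est R a m (thr ε (R.sup fun i => a i * wt m i))

/-- The two-round protocol. -/
def protocol (f : ℝ≥0 → ℝ≥0) (g : (Fin k → ℝ≥0) → ℝ≥0) (ε w Λ : ℝ≥0) (K : ℕ)
    (enc : (Fin k ↪ Fin n) ↪ (Fin b → Bool)) :
    TwoRoundProtocol (Finset (Fin n → ℝ≥0)) (fun W => Set.range (aggregate (k := k) g W)) s b
      (Coins k n s T M M') where
  up₁ j ω W := firstMsg f enc ω (aggregate g W) j
  down _ ω c := (asked f w Λ K enc ω c).toList.map fun i => Word.bits (enc i)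
  up₂ _ _ W d := encodeList enc (aggregate g W)
    (univ.filter fun i => Word.bits (enc i) ∈ d).toList
  out ω c c' := outVal ε ω.1 (asked f w Λ K enc ω c) fun i => f (∑ j, lookup (enc i) (c' j))
  up₁_atomic j ω W x h := by
    rw [firstMsg, List.mem_cons] at h
    exact value_mem_encodeList (h.resolve_left (by simp))
  down_atomic j ω c x h := by
    simp at h
  up₂_atomic j ω W d x h := Or.inl (value_mem_encodeList h)

theorem outVal_congr (ε : ℝ≥0) (m : (Fin k ↪ Fin n) → Fin M) (R : Finset (Fin k ↪ Fin n))
    {a a' : (Fin k ↪ Fin n) → ℝ≥0} (h : ∀ i ∈ R, a i = a' i) :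
    outVal ε m R a = outVal ε m R a' := by
  have : (R.sup fun i => a i * wt m i) = R.sup fun i => a' i * wt m i :=
    sup_congr rfl fun i hi => by rw [h i hi]
  unfold outVal est
  rw [this]
  exact sum_congr rfl fun i hi => by rw [h i hi]

theorem output_protocol (f : ℝ≥0 → ℝ≥0) (g : (Fin k → ℝ≥0) → ℝ≥0) (ε w Λ : ℝ≥0) (K : ℕ)
    (enc : (Fin k ↪ Fin n) ↪ (Fin b → Bool)) (W : Fin s → Finset (Fin n → ℝ≥0))
    (ω : Coins k n s T M M') :
    (protocol f g ε w Λ K enc).output ω W = outVal ε ω.1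
      (asked f w Λ K enc ω fun j => firstMsg f enc ω (aggregate g (W j)) j)
      fun i => f (∑ j, aggregate g (W j) i) := by
  refine outVal_congr _ _ _ fun i hi => ?_
  congr 1
  refine sum_congr rfl fun j _ => ?_
  change lookup (enc i) (encodeList enc _ _) = _
  rw [lookup_encodeList, if_pos]
  rw [mem_toList, mem_filter]
  exact ⟨mem_univ _, List.mem_map.2 ⟨i, mem_toList.2 hi, rfl⟩⟩

/-- Valid for all randomness: `report` truncates the samples at 4T and `cand` has at most K
elements. -/
theorem cost_protocol_le (f : ℝ≥0 → ℝ≥0) (g : (Fin k → ℝ≥0) → ℝ≥0) (ε w Λ : ℝ≥0) (K : ℕ)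
    (enc : (Fin k ↪ Fin n) ↪ (Fin b → Bool)) (W : Fin s → Finset (Fin n → ℝ≥0))
    (ω : Coins k n s T M M') :
    (protocol f g ε w Λ K enc).cost ω W ≤ s * (3 + 8 * T + 3 * K) := by
  have hcost : (protocol f g ε w Λ K enc).cost ω W ≤ ∑ _j : Fin s, (3 + 8 * T + 3 * K) := by
    refine sum_le_sum fun j _ => ?_
    set R := asked f w Λ K enc ω fun j => firstMsg f enc ω (aggregate g (W j)) j with hR
    have hRK : #R ≤ K := card_cand_le _ _ _ _ _ _ _ _
    have h1 : ((protocol f g ε w Λ K enc).msg₁ ω W j).length ≤ 3 + 8 * T := by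
      change (firstMsg f enc ω (aggregate g (W j)) j).length ≤ _
      rw [firstMsg, List.length_cons, length_encodeList, report, List.length_append]
      have ha := List.length_take_le 1
        (univ.filter fun i => f (aggregate g (W j) i) * wt ω.1 i
          = vmax f ω.1 (aggregate g (W j))).toList
      have hb := List.length_take_le (4 * T)
        (samp f ω.1 ω.2 (aggregate g (W j)) (load f ω.1 (aggregate g (W j))) j).toList
      omega
    have h2 : ((protocol f g ε w Λ K enc).answer ω W j).length ≤ K := by
      change (R.toList.map fun i => Word.bits (enc i)).length ≤ K
      rwa [List.length_map, length_toList]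
    have h3 : ((protocol f g ε w Λ K enc).msg₂ ω W j).length ≤ 2 * K := by
      change (encodeList enc (aggregate g (W j)) (univ.filter fun i => Word.bits (enc i) ∈
        R.toList.map fun i => Word.bits (enc i)).toList).length ≤ _
      rw [length_encodeList, length_toList]
      have : (univ.filter fun i => (Word.bits (enc i) : Word b) ∈
          R.toList.map fun i => Word.bits (enc i)) = R := by
        ext i
        simp
      rw [this]
      omega
    omega
  refine hcost.trans_eq ?_
  simp

/-- If no server samples too much, the coordinator asks about the right candidates. -/
theorem asked_eq {f : ℝ≥0 → ℝ≥0} {θ θ' θ'' : ℝ≥0} (hf : ApproxInvertible f θ θ' θ'')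
    {w : ℝ≥0} (hw : 1 < w) (Λ : ℝ≥0) (K : ℕ) (enc : (Fin k ↪ Fin n) ↪ (Fin b → Bool))
    (ω : Coins k n s T M M') (x : Fin s → (Fin k ↪ Fin n) → ℝ≥0)
    (hshort : ∀ j, #(samp f ω.1 ω.2 (x j) (load f ω.1 (x j)) j) ≤ 4 * T) :
    asked f w Λ K enc ω (fun j => firstMsg f enc ω (x j) j)
      = cand f w Λ ω.1 ω.2 K x fun j => load f ω.1 (x j) := by
  set c : Fin s → List (Word b) := fun j => firstMsg f enc ω (x j) j with hc
  have hseen : ∀ j i, seen enc c j i = if i ∈ report f ω (x j) j then x j i else 0 :=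
    fun j i => by
      unfold seen
      convert lookup_encodeList enc (x j) (report f ω (x j) j) i
      rfl
  have hy : ∀ j i, seen enc c j i = x j i ∨ seen enc c j i = 0 := by
    intro j i
    rw [hseen]
    split_ifs
    · exact Or.inl rfl
    · exact Or.inr rfl
  -- The report begins with a maximiser, and unreported entries are read as 0.
  have hvmax : ∀ j, vmax f ω.1 (seen enc c j) = vmax f ω.1 (x j) := by
    intro j
    refine le_antisymm (Finset.sup_le fun i _ => ?_) ?_
    · refine le_trans (mul_le_mul_left (hf.mono ?_) _) (le_vmax f ω.1 (x j) i)
      rcases hy j i with h | h <;> rw [h]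
      exact zero_le
    · rcases isEmpty_or_nonempty (Fin k ↪ Fin n) with h | h
      · simp [vmax]
      · obtain ⟨i0, -, hi0⟩ := exists_mem_eq_sup (univ : Finset (Fin k ↪ Fin n)) univ_nonempty
          fun i => f (x j i) * wt ω.1 i
        set l := (univ.filter fun i => f (x j i) * wt ω.1 i = vmax f ω.1 (x j)).toList with hl
        have hne : l ≠ [] := by
          have : i0 ∈ l := mem_toList.2 (mem_filter.2 ⟨mem_univ _, hi0.symm⟩)
          exact List.ne_nil_of_mem this
        obtain ⟨i1, l', hl'⟩ := List.exists_cons_of_ne_nil hne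
        have hi1 : f (x j i1) * wt ω.1 i1 = vmax f ω.1 (x j) := by
          have : i1 ∈ l := by rw [hl']; simp
          exact (mem_filter.1 (mem_toList.1 this)).2
        have hmem : i1 ∈ report f ω (x j) j := by
          rw [report, ← hl, hl']
          simp
        calc vmax f ω.1 (x j) = f (seen enc c j i1) * wt ω.1 i1 := by
              rw [hseen, if_pos hmem, hi1]
          _ ≤ _ := le_vmax f ω.1 (seen enc c j) i1
  have hload : seenLoad f enc ω c = fun j => load f ω.1 (x j) := by
    funext j
    have hcard : Fintype.card (Fin k ↪ Fin n) ≤ 2 ^ b := by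
      have := Fintype.card_le_of_embedding enc
      simpa using this
    have hnum : headNum (c j) = ratio f ω.1 (x j) :=
      numOf_ofNum (ratio_lt f ω.1 (x j) (by positivity) hcard)
    rw [seenLoad, hnum, hvmax, load]
  rw [asked, hload]
  refine cand_congr hf hw Λ ω.1 ω.2 K hy (fun j i hi => ?_) fun j i => ?_
  · rw [hseen, if_pos]
    rw [report, List.mem_append, List.take_of_length_le (i := 4 * T) (by rw [length_toList]; exact hshort j)]
    exact Or.inr (mem_toList.2 hi)
  · exact (single_le_sum (f := fun i => f (x j i) * wt ω.1 i) (fun _ _ => zero_le)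
      (mem_univ i)).trans (load_bounds f ω.1 (x j)).1

/-- On good randomness the output is accurate. -/
theorem abs_outVal_sub_le {f : ℝ≥0 → ℝ≥0} {θ θ' θ'' : ℝ≥0} (hf : ApproxInvertible f θ θ' θ'')
    {w Λ ε α L : ℝ≥0} (hw : 1 < w) (hε : 0 < ε) {K : ℕ} (enc : (Fin k ↪ Fin n) ↪ (Fin b → Bool))
    (ω : Coins k n s T M M') (x : Fin s → (Fin k ↪ Fin n) → ℝ≥0)
    (hF : 0 < ∑ i, f (∑ j, x j i)) (hα : 0 < α) (hK : α * L ≤ K)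
    (hL : ∑ i, f (∑ j, x j i) * wt ω.1 i ≤ L * (ε ^ 2 * (∑ i, f (∑ j, x j i)) / (64 * 10 ^ 8)))
    (hε1 : ε ≤ 1) (hm : GoodWeights (fun i => f (∑ j, x j i)) ε ω.1)
    (hu : GoodSamples f w Λ ω.1 x (fun j => load f ω.1 (x j)) α
      (ε ^ 2 * (∑ i, f (∑ j, x j i)) / (64 * 10 ^ 8)) ω.2) :
    |outVal ε ω.1 (asked f w Λ K enc ω fun j => firstMsg f enc ω (x j) j)
      (fun i => f (∑ j, x j i)) - (∑ i, f (∑ j, x j i) : ℝ≥0)|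
      ≤ ε * (∑ i, f (∑ j, x j i) : ℝ≥0) := by
  set a : (Fin k ↪ Fin n) → ℝ≥0 := fun i => f (∑ j, x j i) with ha
  set F := ∑ i, f (∑ j, x j i) with hFd
  set τ := ε ^ 2 * F / (64 * 10 ^ 8) with hτ
  have hτ0 : 0 < τ := by positivity
  rw [asked_eq hf hw Λ K enc ω x hu.short]
  set R := cand f w Λ ω.1 ω.2 K x fun j => load f ω.1 (x j) with hR
  have hmem : ∀ i, τ ≤ a i * wt ω.1 i → i ∈ R := fun i hi =>
    subset_cand hf hw hu hα hτ0 hL hK hi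
  obtain ⟨i1, hi1⟩ := hm.exists_le
  obtain ⟨i0, -, hi0⟩ := exists_max_image univ (fun i => a i * wt ω.1 i) ⟨i1, mem_univ i1⟩
  have hbig : F / 3200 ≤ a i0 * wt ω.1 i0 := hi1.trans (hi0 i1 (mem_univ i1))
  have hεF : ε ^ 2 * F ≤ F := mul_le_of_le_one_left zero_le (pow_le_one₀ zero_le hε1)
  have hτF : τ ≤ F / 3200 := by
    rw [hτ]
    refine div_le_div₀ zero_le hεF (by norm_num) (by norm_num)
  have hi0R : i0 ∈ R := hmem i0 (hτF.trans hbig)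
  have hV : (R.sup fun i => a i * wt ω.1 i) = a i0 * wt ω.1 i0 :=
    le_antisymm (Finset.sup_le fun i _ => hi0 i (mem_univ i))
      (le_sup (f := fun i => a i * wt ω.1 i) hi0R)
  have hV0 : 0 < a i0 * wt ω.1 i0 := lt_of_lt_of_le (by positivity) hbig
  have hest := hm.est_le (a i0 * wt ω.1 i0) (fun i => hi0 i (mem_univ i)) ⟨i0, rfl⟩
  -- Here 64 · 10^8 = 2 · 3200 · 10^6: the maximum is at least F/3200, and rounding to a power of
  -- two loses less than a factor of two.
  have hthr : τ ≤ thr ε (a i0 * wt ω.1 i0) := by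
    have h1 := (lg_spec (w := 2) (x := ε ^ 2 * (a i0 * wt ω.1 i0) / 10 ^ 6) one_lt_two
      (by positivity)).2
    rw [zpow_add₀ two_ne_zero, zpow_one] at h1
    change τ ≤ 2 ^ lg 2 (ε ^ 2 * (a i0 * wt ω.1 i0) / 10 ^ 6)
    refine le_of_mul_le_mul_right (le_trans ?_ h1.le) two_pos
    have h2 : ε ^ 2 * (F / 3200) ≤ ε ^ 2 * (a i0 * wt ω.1 i0) := by gcongr
    have h3 : τ * 2 = ε ^ 2 * (F / 3200) / 10 ^ 6 := by
      rw [hτ, ← NNReal.coe_inj]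
      push_cast
      ring
    rw [h3]
    gcongr
  have hR' : outVal ε ω.1 R a = est univ a ω.1 (thr ε (a i0 * wt ω.1 i0)) := by
    rw [outVal, hV]
    refine sum_subset (subset_univ R) fun i _ hi => ?_
    rw [if_neg]
    exact fun h => hi (hmem i (hthr.trans h))
  rw [hR']
  exact hest

theorem outVal_eq_zero (ε : ℝ≥0) (m : (Fin k ↪ Fin n) → Fin M) (R : Finset (Fin k ↪ Fin n))
    {a : (Fin k ↪ Fin n) → ℝ≥0} (h : ∀ i, a i = 0) : outVal ε m R a = 0 := by
  unfold outVal est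
  refine sum_eq_zero fun i _ => ?_
  simp [h i]

/-- The probability that the randomness is not good. -/
theorem pr_abs_outVal_sub_le {f : ℝ≥0 → ℝ≥0} {θ θ' θ'' : ℝ≥0} (hf : ApproxInvertible f θ θ' θ'')
    {Λ ε L : ℝ≥0} {K D N : ℕ} (enc : (Fin k ↪ Fin n) ↪ (Fin b → Bool))
    (hs : 1 ≤ s) (hM : 1 ≤ M) (hc : Fintype.card (Fin k ↪ Fin n) ≤ M)
    (hN : 2 * (s : ℝ≥0) ≤ NNReal.sqrt θ ^ N) (hND : (N + 1) ^ 2 ≤ D)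
    (hε : 0 < ε) (hε1 : ε < 1) (hΛ : 1 ≤ Λ) (hTΛ : Λ ≤ T)
    (hT : 32 * Λ * (cParam f s / s) * θ'' ^ 2 * cParam f D * L ≤ T) (hM' : T * s ≤ M')
    (hL : 64 * 10 ^ 10 * (1 + Real.log M) ≤ L * ε ^ 2) (hK : θ'' ^ 3 * cParam f D * L ≤ K)
    (hexp : ((Fintype.card (Fin k ↪ Fin n) : ℝ) * s ^ 2 + Fintype.card (Fin k ↪ Fin n) + s)
      * Real.exp (-(19 / 100 * Λ)) ≤ 1 / 20)
    (x : Fin s → (Fin k ↪ Fin n) → ℝ≥0) :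
    pr (fun ω : Coins k n s T M M' => ¬ |outVal ε ω.1 (asked f (NNReal.sqrt θ) Λ K enc ω fun j =>
      firstMsg f enc ω (x j) j) (fun i => f (∑ j, x j i)) - (∑ i, f (∑ j, x j i) : ℝ≥0)|
      ≤ ε * (∑ i, f (∑ j, x j i) : ℝ≥0)) ≤ 1 / 10 := by
  have hw : 1 < NNReal.sqrt θ := hf.one_lt_sqrt
  set F := ∑ i, f (∑ j, x j i) with hF
  rcases eq_or_ne F 0 with h0 | h0
  · refine (pr_mono (q := fun _ => False) fun ω hω => hω ?_).trans (by rw [pr_false]; norm_num)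
    have hz : ∀ i, f (∑ j, x j i) = 0 := fun i => (sum_eq_zero_iff.1 h0) i (mem_univ i)
    rw [outVal_eq_zero ε _ _ hz, h0]
    simp
  have hFpos : 0 < F := pos_iff_ne_zero.2 h0
  set τ := ε ^ 2 * F / (64 * 10 ^ 8) with hτ
  have hτ0 : 0 < τ := by positivity
  have hne : Nonempty (Fin M) := ⟨⟨0, hM⟩⟩
  have hθ'' : 0 < θ'' := zero_lt_one.trans hf.one_lt''
  have hD1 : 1 ≤ D := le_trans (Nat.one_le_pow _ _ (by omega)) hND
  have hΓ : 0 < cParam f D := by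
    obtain ⟨i, -, hi⟩ := exists_ne_zero_of_sum_ne_zero h0
    exact lt_of_lt_of_le (Nat.cast_pos.2 hD1) (hf.le_cParam hD1 hi)
  have hsumL : ∀ m : (Fin k ↪ Fin n) → Fin M, GoodWeights (fun i => f (∑ j, x j i)) ε m →
      ∑ i, f (∑ j, x j i) * wt m i ≤ L * τ := by
    intro m hm
    have h1 := hm.sum_le
    rw [← NNReal.coe_le_coe]
    refine h1.trans ?_
    rw [← hF, hτ]
    have hF' : (0 : ℝ) < F := hFpos
    push_cast
    have h2 := mul_le_mul_of_nonneg_left hL hF'.le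
    rw [mul_div_assoc', le_div_iff₀ (by norm_num)]
    nlinarith
  have hmain := pr_prod_le (Ω := (Fin k ↪ Fin n) → Fin M)
    (Ω' := (Fin k ↪ Fin n) × Fin s × Fin T → Fin M')
    (fun m => ¬ GoodWeights (fun i => f (∑ j, x j i)) ε m)
    (fun m u => ¬ GoodSamples f (NNReal.sqrt θ) Λ m x (fun j => load f m (x j))
      (θ'' ^ 3 * cParam f D) τ u) (a := 47 / 1000) (b := 1 / 20) (by norm_num)
    (by
      convert pr_not_goodWeights_le hM hc (fun i => f (∑ j, x j i)) hε hε1 hFpos)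
    (by
      intro m hm
      rw [not_not] at hm
      -- Superadditivity bounds the sum of the servers' weighted totals by the global one; the 2
      -- comes from rounding the loads.
      have hsum : ∑ j, load f m (x j) ≤ 2 * (L * τ) := by
        calc ∑ j, load f m (x j) ≤ ∑ j, 2 * ∑ i, f (x j i) * wt m i :=
              sum_le_sum fun j _ => (load_bounds f m (x j)).2
          _ = 2 * ∑ i, (∑ j, f (x j i)) * wt m i := by
              rw [← mul_sum, sum_comm]
              simp only [sum_mul]
          _ ≤ 2 * ∑ i, f (∑ j, x j i) * wt m i := by
              gcongr with i _
              exact hf.sum_le univ fun j => x j i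
          _ ≤ _ := by
              gcongr
              exact hsumL m hm
      have := pr_not_goodSamples_le hf hs hN hND (fun j => (load_bounds f m (x j)).1) hsum hτ0
        hΛ hTΛ hT hM'
      refine le_trans ?_ (this.trans hexp)
      apply le_of_eq
      congr!)
  refine le_trans (pr_mono fun ω hω => ?_) (hmain.trans (by norm_num))
  by_contra hcon
  push Not at hcon
  exact hω (abs_outVal_sub_le hf hw hε enc ω x hFpos (by positivity) hK (hsumL _ hcon.1)
    hε1.le hcon.1 hcon.2)

/-- The uniform measure on a finite type. -/
theorem exists_uniform (Ω : Type) [Fintype Ω] [Nonempty Ω] :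
    ∃ (_ : MeasurableSpace Ω) (P : Measure Ω) (_ : IsProbabilityMeasure P),
      ∀ p : Ω → Prop, MeasurableSet {ω | p ω} ∧
        (pr (fun ω => ¬ p ω) ≤ 1 / 10 → 9 / 10 ≤ P {ω | p ω}) := by
  let _ : MeasurableSpace Ω := ⊤
  refine ⟨⊤, (PMF.uniformOfFintype Ω).toMeasure, inferInstance, fun p => ⟨trivial, fun h => ?_⟩⟩
  have hm : MeasurableSet {ω | p ω} := trivial
  rw [PMF.toMeasure_uniformOfFintype_apply _ hm]
  rw [pr_not] at h
  have h1 : pr p = (Fintype.card {ω | p ω} : ℝ) / Fintype.card Ω := by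
    rw [pr, avg, sum_boole]
    congr 2
    exact (Fintype.card_subtype p).symm
  have h2 : (9 : ℝ) / 10 ≤ (Fintype.card {ω | p ω} : ℝ) / Fintype.card Ω := by linarith
  have hc : (0 : ℝ) < Fintype.card Ω := Nat.cast_pos.2 Fintype.card_pos
  rw [div_le_div_iff₀ (by norm_num) hc] at h2
  have h3 : 9 * Fintype.card Ω ≤ Fintype.card {ω | p ω} * 10 := by exact_mod_cast h2
  rw [ENNReal.div_le_iff (by norm_num) (by norm_num), mul_comm, ← mul_div_assoc,
    ENNReal.le_div_iff_mul_le (by simp) (by simp)]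
  rw [mul_comm (10 : ENNReal)]
  exact_mod_cast h3

end Protocol

end FiniteProb

/-! ### Choice of parameters and the communication budget. -/

namespace FiniteProb

open Finset

/-- The protocol that sends nothing and outputs zero. -/
def silentProtocol (I : Type) (held : I → Set ℝ≥0) (s b : ℕ) : TwoRoundProtocol I held s b Unit where
  up₁ _ _ _ := []
  down _ _ _ := []
  up₂ _ _ _ _ := []
  out _ _ _ := 0
  up₁_atomic j ω a x h := by simp at h
  down_atomic j ω m x h := by simp at h
  up₂_atomic j ω a d x h := by simp at h

theorem exists_enc (n k : ℕ) :
    Fintype.card (Fin k ↪ Fin n) ≤ n ^ k ∧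
      Nonempty ((Fin k ↪ Fin n) ↪ (Fin (k * Nat.clog 2 n) → Bool)) := by
  have h1 : Fintype.card (Fin k ↪ Fin n) ≤ n ^ k := by
    rw [Fintype.card_embedding_eq, Fintype.card_fin, Fintype.card_fin]
    exact Nat.descFactorial_le_pow n k
  refine ⟨h1, Function.Embedding.nonempty_of_card_le (h1.trans ?_)⟩
  simp only [Fintype.card_fun, Fintype.card_fin, Fintype.card_bool]
  rw [mul_comm, pow_mul]
  exact Nat.pow_le_pow_left (Nat.le_pow_clog one_lt_two n) k

/-- The number of exponents of values within a factor `2 s` of each other is small. -/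
theorem exists_exponent_bound {s : ℕ} (hs : 1 ≤ s) {θ θ'' : ℝ≥0} (hθ : 1 < θ) (h4 : 4 * θ ≤ θ'')
    {C : ℝ} (hC : 4 ≤ C) :
    ∃ N : ℕ, 2 * (s : ℝ≥0) ≤ NNReal.sqrt θ ^ N ∧
      (N + 1) ^ 2 ≤ bucketsA C s θ θ'' * bucketsB C s θ θ'' ∧
      Real.log (s * θ'') / Real.log θ ≤ (bucketsA C s θ θ'' : ℝ) * bucketsB C s θ θ'' := by
  have hθ' : (1 : ℝ) < θ := by exact_mod_cast hθ
  have h4' : 4 * (θ : ℝ) ≤ θ'' := by exact_mod_cast h4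
  have hs' : (1 : ℝ) ≤ s := by exact_mod_cast hs
  have hl : 0 < Real.log θ := Real.log_pos hθ'
  set r := Real.log (s * θ'') / Real.log θ with hr
  have hr1 : 1 ≤ r := by
    rw [hr, le_div_iff₀ hl, one_mul]
    refine Real.log_le_log (by linarith) ?_
    nlinarith
  have hA : C * r ≤ bucketsA C s θ θ'' := by
    rw [hr, ← mul_div_assoc]
    exact Nat.le_ceil _
  have hB : C * r ≤ bucketsB C s θ θ'' := by
    refine le_trans ?_ (Nat.le_ceil _)
    rw [hr, ← mul_div_assoc]
    have hθ''1 : (1 : ℝ) ≤ θ'' := by linarith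
    gcongr
    · exact le_self_pow₀ hs' two_ne_zero
    · exact le_self_pow₀ hθ''1 two_ne_zero
  -- Since r ≥ 1, N + 1 ≤ 2r + 2 ≤ 4r, and both bucket numbers are at least Cr.
  have hCr : 4 * r ≤ C * r := by gcongr
  refine ⟨⌈2 * Real.log (2 * s) / Real.log θ⌉₊, ?_, ?_, ?_⟩
  · set N := ⌈2 * Real.log (2 * s) / Real.log θ⌉₊ with hN
    have h1 : 2 * Real.log (2 * s) / Real.log θ ≤ N := Nat.le_ceil _
    rw [div_le_iff₀ hl] at h1
    rw [← NNReal.coe_le_coe]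
    push_cast
    rw [← Real.log_le_log_iff (by positivity) (by positivity), Real.log_pow, Real.log_sqrt (by positivity)]
    linarith
  · have h1 : (⌈2 * Real.log (2 * s) / Real.log θ⌉₊ : ℝ) ≤ 2 * r + 1 := by
      refine (Nat.ceil_lt_add_one ?_).le.trans ?_
      · have : 0 ≤ Real.log (2 * s) := Real.log_nonneg (by linarith)
        positivity
      · rw [hr, ← mul_div_assoc]
        gcongr 2 * ?_ / _ + 1
        exact Real.log_le_log (by positivity) (by nlinarith)
    have h2 : ((⌈2 * Real.log (2 * s) / Real.log θ⌉₊ + 1 : ℕ) : ℝ) ≤ C * r := by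
      push_cast
      linarith
    have h3 : ⌈2 * Real.log (2 * s) / Real.log θ⌉₊ + 1 ≤ bucketsA C s θ θ'' := by
      exact_mod_cast h2.trans hA
    have h4 : ⌈2 * Real.log (2 * s) / Real.log θ⌉₊ + 1 ≤ bucketsB C s θ θ'' := by
      exact_mod_cast h2.trans hB
    rw [sq]
    exact Nat.mul_le_mul h3 h4
  · nlinarith

/-- As 6 · 19/100 > 1, each bad event has probability at most 1/Q, and Q is 20 times the bound 3Ms²
for the number of events. -/
theorem exp_bound {M s c Q Λ : ℝ} (hM : 1 ≤ M) (hs : 1 ≤ s) (hc : c ≤ M)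
    (hQ : Q = 60 * M * s ^ 2) (hΛ : Λ = 6 * Real.log Q) :
    (c * s ^ 2 + c + s) * Real.exp (-(19 / 100 * Λ)) ≤ 1 / 20 := by
  have hs2 : 1 ≤ s ^ 2 := one_le_pow₀ hs
  have hMs : 1 ≤ M * s ^ 2 := one_le_mul_of_one_le_of_one_le hM hs2
  have hQ1 : 1 ≤ Q := by rw [hQ]; linarith
  have hlog : 0 ≤ Real.log Q := Real.log_nonneg hQ1
  have h1 : Real.exp (-(19 / 100 * Λ)) ≤ Q⁻¹ := by
    calc Real.exp (-(19 / 100 * Λ)) ≤ Real.exp (-Real.log Q) := by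
          rw [Real.exp_le_exp, hΛ]
          linarith
      _ = Q⁻¹ := by rw [Real.exp_neg, Real.exp_log (by linarith)]
  have h2 : c * s ^ 2 + c + s ≤ 3 * (M * s ^ 2) := by
    have e1 : c * s ^ 2 ≤ M * s ^ 2 := by gcongr
    have e2 : c ≤ M * s ^ 2 := hc.trans (le_mul_of_one_le_right (by linarith) hs2)
    have e3 : s ≤ M * s ^ 2 := by nlinarith
    linarith
  calc (c * s ^ 2 + c + s) * Real.exp (-(19 / 100 * Λ)) ≤ 3 * (M * s ^ 2) * Q⁻¹ := by gcongr
    _ = 1 / 20 := by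
      rw [hQ]
      field_simp
      norm_num

/-- The arithmetic behind the bound on the communication. -/
theorem cost_arith {ℓ r t q Λ P C : ℝ} (hΛ0 : 0 ≤ Λ) (hℓ : Real.log 2 ≤ ℓ) (hr : 1 ≤ r) (ht : 1 ≤ t)
    (hq : 1 ≤ q) (hP : r ≤ P) (hΛ : Λ ≤ 6 * (6 * ℓ + ℓ + 2 * (r * t))) (hC : 10 ^ 18 ≤ C) :
    64 * 10 ^ 10 * (1 + ℓ) * (608 * Λ * t ^ 2 + 6 * t ^ 3) ≤ C * (P * q * t ^ 3 * ℓ ^ 4) := by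
  have hl2 := Real.log_two_gt_d9
  have hℓ1 : 69 / 100 ≤ ℓ := by linarith
  have hrt : 1 ≤ r * t := one_le_mul_of_one_le_of_one_le hr ht
  have h1 : Λ ≤ 60 * ℓ * (r * t) := by nlinarith
  have h2 : 608 * Λ * t ^ 2 + 6 * t ^ 3 ≤ 40000 * (ℓ * r * t ^ 3) := by
    have e1 : 608 * Λ * t ^ 2 ≤ 608 * (60 * ℓ * (r * t)) * t ^ 2 := by gcongr
    have e2 : 1 ≤ 2 * (ℓ * r) := by nlinarith
    have e3 : t ^ 3 * 1 ≤ t ^ 3 * (2 * (ℓ * r)) := by gcongr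
    nlinarith
  have h3 : 1 + ℓ ≤ 3 * ℓ := by linarith
  have h4 : ℓ ^ 2 ≤ 3 * ℓ ^ 4 := by
    have : 1 ≤ 3 * ℓ ^ 2 := by nlinarith
    nlinarith [sq_nonneg ℓ]
  calc 64 * 10 ^ 10 * (1 + ℓ) * (608 * Λ * t ^ 2 + 6 * t ^ 3)
      ≤ 64 * 10 ^ 10 * (3 * ℓ) * (40000 * (ℓ * r * t ^ 3)) := by gcongr
    _ = 64 * 10 ^ 10 * 3 * 40000 * (r * t ^ 3) * ℓ ^ 2 := by ring
    _ ≤ 64 * 10 ^ 10 * 3 * 40000 * (r * t ^ 3) * (3 * ℓ ^ 4) := by gcongr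
    _ = (64 * 10 ^ 10 * 3 * 40000 * 3) * (r * 1 * t ^ 3 * ℓ ^ 4) := by ring
    _ ≤ C * (P * q * t ^ 3 * ℓ ^ 4) := by
        -- The product is about 2.3 · 10^17; this determines the size of C.
        have : (64 * 10 ^ 10 * 3 * 40000 * 3 : ℝ) ≤ C := le_trans (by norm_num) hC
        have : 0 ≤ P := by linarith
        gcongr

/-- The communication is within the budget. -/
theorem cost_le_budget {s k n : ℕ} (hs : 1 ≤ s) (hk : 1 ≤ k) (hn : 2 ≤ n) {θ θ'' Λ L ε : ℝ≥0}
    {c Γ A B C : ℝ} (hθ : 1 < θ) (h4 : 4 * θ ≤ θ'') (hε : 0 < ε)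
    (hr : Real.log (s * θ'') / Real.log θ ≤ A * B)
    (hΛ : (Λ : ℝ) = 6 * Real.log (60 * (n ^ k : ℕ) * s ^ 2))
    (hLε : 64 * 10 ^ 10 * (1 + Real.log (n ^ k : ℕ)) = L * ε ^ 2) (hc : 0 ≤ c) (hΓ : 0 ≤ Γ)
    (hC : 10 ^ 18 ≤ C) :
    c * Γ * L * (608 * Λ * θ'' ^ 2 + 6 * θ'' ^ 3) ≤ C * (c / ε ^ 2 *
      (Γ * (A * B) * Real.sqrt θ * (θ'' : ℝ) ^ 3 * (k : ℝ) ^ 4 * Real.log n ^ 4)) := by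
  have hθ' : (1 : ℝ) < θ := by exact_mod_cast hθ
  have hs' : (1 : ℝ) ≤ s := by exact_mod_cast hs
  have hε' : (0 : ℝ) < ε := hε
  have hn' : (n : ℝ) ≠ 0 := by positivity
  set r := Real.log (s * θ'') / Real.log θ with hrdef
  set ℓ := Real.log (n ^ k : ℕ) with hℓ
  have hℓk : ℓ = k * Real.log n := by rw [hℓ]; push_cast; rw [Real.log_pow]
  have hℓ2 : Real.log 2 ≤ ℓ := by
    rw [hℓ]
    refine Real.log_le_log two_pos ?_
    have : 2 ^ 1 ≤ n ^ k := (Nat.pow_le_pow_right two_pos hk).trans (Nat.pow_le_pow_left hn k)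
    exact_mod_cast this
  have hl2 := Real.log_two_gt_d9
  have h4' : 4 * (θ : ℝ) ≤ θ'' := by exact_mod_cast h4
  have hθ''R : (1 : ℝ) ≤ θ'' := by linarith
  have hlθ : 0 < Real.log θ := Real.log_pos hθ'
  have hr1 : 1 ≤ r := by
    rw [hrdef, le_div_iff₀ hlθ, one_mul]
    refine Real.log_le_log (by linarith) ?_
    nlinarith
  -- Λ contains log s, which the budget does not. It is absorbed by r ≤ AB and the third factor θ'',
  -- the sample count otherwise using only θ''².
  have hlogs : Real.log s ≤ r * θ'' := by
    calc Real.log s ≤ Real.log (s * θ'') := Real.log_le_log (by linarith) (by nlinarith)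
      _ = r * Real.log θ := by rw [hrdef, div_mul_cancel₀ _ hlθ.ne']
      _ ≤ r * θ'' := by
          gcongr
          have := Real.log_le_sub_one_of_pos (by linarith : (0 : ℝ) < θ)
          linarith
  have hlog60 : Real.log 60 ≤ 6 * ℓ := by
    have : Real.log 60 ≤ Real.log (2 ^ 6) := Real.log_le_log (by norm_num) (by norm_num)
    rw [Real.log_pow] at this
    push_cast at this
    linarith
  have hΛ2 : (Λ : ℝ) ≤ 6 * (6 * ℓ + ℓ + 2 * (r * θ'')) := by
    rw [hΛ, Real.log_mul (by positivity) (by positivity), Real.log_mul (by norm_num)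
      (by positivity), Real.log_pow]
    push_cast at hlogs ⊢
    have : Real.log ((n : ℝ) ^ k) = ℓ := by rw [hℓ]; push_cast; rfl
    rw [this]
    linarith
  have hkey := cost_arith (q := Real.sqrt θ) Λ.2 hℓ2 hr1 hθ''R
    (Real.one_le_sqrt.2 hθ'.le) hr hΛ2 hC
  rw [hLε] at hkey
  have hcΓ : (0 : ℝ) ≤ c * Γ / ε ^ 2 := by positivity
  calc c * Γ * L * (608 * Λ * θ'' ^ 2 + 6 * θ'' ^ 3)
      = c * Γ / ε ^ 2 * (L * ε ^ 2 * (608 * Λ * θ'' ^ 2 + 6 * θ'' ^ 3)) := by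
        field_simp
    _ ≤ c * Γ / ε ^ 2 * (C * (A * B * Real.sqrt θ * θ'' ^ 3 * ℓ ^ 4)) :=
        mul_le_mul_of_nonneg_left hkey hcΓ
    _ = _ := by rw [hℓk]; ring

theorem exists_protocol {s k n : ℕ} (hs : 1 ≤ s) (hk : 1 ≤ k) (hn : 2 ≤ n) {f : ℝ≥0 → ℝ≥0}
    {θ θ' θ'' : ℝ≥0} (hf : ApproxInvertible f θ θ' θ'') {y : ℝ≥0} (hy : f y ≠ 0)
    (g : (Fin k → ℝ≥0) → ℝ≥0) {ε : ℝ≥0} (hε : 0 < ε) (hε1 : ε < 1) {C : ℝ} (hC : 10 ^ 18 ≤ C) :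
    ∃ (Ω : Type) (_ : MeasurableSpace Ω) (P : Measure Ω) (_ : IsProbabilityMeasure P)
      (p : TwoRoundProtocol (Finset (Fin n → ℝ≥0)) (fun W => Set.range (aggregate (k := k) g W))
        s (k * Nat.clog 2 n) Ω),
      (∀ (W : Fin s → Finset (Fin n → ℝ≥0)) (ω : Ω), (p.cost ω W : ℝ) ≤
        C * ((cParam f s : ℝ) / ε ^ 2 *
          ((cParam f (bucketsA C s θ θ'' * bucketsB C s θ θ'') : ℝ) *
            ((bucketsA C s θ θ'' : ℝ) * (bucketsB C s θ θ'' : ℝ)) *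
            Real.sqrt (θ : ℝ) * (θ'' : ℝ) ^ 3 * (k : ℝ) ^ 4 * Real.log n ^ 4))) ∧
      ∀ W : Fin s → Finset (Fin n → ℝ≥0),
        ∃ E : Set Ω, MeasurableSet E ∧ 9 / 10 ≤ P E ∧ ∀ ω ∈ E,
          |p.output ω W - (correlation f g W : ℝ)| ≤ ε * (correlation f g W : ℝ) := by
  have h4 := hf.four_mul_le hy
  have hθ''1 : 1 ≤ θ'' := hf.one_lt''.le
  have hθ' : (1 : ℝ) < θ := by exact_mod_cast hf.one_lt
  have hs' : (1 : ℝ) ≤ s := by exact_mod_cast hs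
  obtain ⟨N, hN, hND, hr⟩ := exists_exponent_bound hs hf.one_lt h4
    (le_trans (by norm_num) hC : (4 : ℝ) ≤ C)
  set A := bucketsA C s θ θ''
  set B := bucketsB C s θ θ''
  set r := Real.log (s * θ'') / Real.log θ with hrdef
  have hD : 1 ≤ A * B := le_trans (Nat.one_le_pow _ _ (by omega)) hND
  obtain ⟨hcard, ⟨enc⟩⟩ := exists_enc n k
  have hM1 : 1 ≤ n ^ k := Nat.one_le_pow _ _ (by omega)
  have hM1' : (1 : ℝ) ≤ (n ^ k : ℕ) := by exact_mod_cast hM1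
  set ℓ := Real.log (n ^ k : ℕ) with hℓ
  have hℓ2 : Real.log 2 ≤ ℓ := by
    rw [hℓ]
    refine Real.log_le_log two_pos ?_
    have : 2 ^ 1 ≤ n ^ k := (Nat.pow_le_pow_right two_pos hk).trans (Nat.pow_le_pow_left hn k)
    exact_mod_cast this
  have hl2 := Real.log_two_gt_d9
  have hQ1 : (60 : ℝ) ≤ 60 * (n ^ k : ℕ) * s ^ 2 := by
    have := one_le_mul_of_one_le_of_one_le hM1' (one_le_pow₀ (n := 2) hs')
    linarith
  have hlogQ : 1 ≤ Real.log (60 * (n ^ k : ℕ) * s ^ 2) := by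
    refine (Real.le_log_iff_exp_le (by linarith)).2 ?_
    linarith [Real.exp_one_lt_d9]
  obtain ⟨Λ, hΛ⟩ : ∃ Λ : ℝ≥0, (Λ : ℝ) = 6 * Real.log (60 * (n ^ k : ℕ) * s ^ 2) :=
    ⟨⟨_, by linarith⟩, rfl⟩
  have hΛ1 : 1 ≤ Λ := by
    rw [← NNReal.coe_le_coe, hΛ, NNReal.coe_one]
    linarith
  have hε' : (0 : ℝ) < ε := hε
  have hε1' : (ε : ℝ) < 1 := hε1
  obtain ⟨L, hL⟩ : ∃ L : ℝ≥0, (L : ℝ) = 64 * 10 ^ 10 * (1 + ℓ) / ε ^ 2 :=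
    ⟨⟨_, by have : 0 ≤ ℓ := by linarith
            positivity⟩, rfl⟩
  have hLε : 64 * 10 ^ 10 * (1 + ℓ) = L * ε ^ 2 := by
    rw [hL, div_mul_cancel₀ _ (by positivity)]
  have hL1 : 1 ≤ L := by
    rw [← NNReal.coe_le_coe, hL, NNReal.coe_one, le_div_iff₀ (by positivity)]
    nlinarith
  set c := cParam f s with hc
  set Γ := cParam f (A * B) with hΓ
  have hcs : (s : ℝ≥0) ≤ c := hf.le_cParam hs hy
  have hs0 : (0 : ℝ≥0) < s := Nat.cast_pos.2 hs
  have hcs1 : 1 ≤ c / s := (one_le_div hs0).2 hcs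
  have hΓ1 : 1 ≤ Γ := le_trans (by exact_mod_cast hD) (hf.le_cParam hD hy)
  set T0 : ℝ≥0 := 32 * Λ * (c / s) * θ'' ^ 2 * Γ * L with hT0
  set K0 : ℝ≥0 := θ'' ^ 3 * Γ * L with hK0
  have hK01 : 1 ≤ K0 := one_le_mul (one_le_mul (one_le_pow₀ hθ''1) hΓ1) hL1
  have hT0Λ : Λ ≤ T0 := by
    calc Λ = 1 * Λ * 1 * 1 * 1 * 1 := by ring
      _ ≤ 32 * Λ * (c / s) * θ'' ^ 2 * Γ * L := by
          gcongr
          · norm_num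
          · exact one_le_pow₀ hθ''1
  set T := ⌈T0⌉₊ with hT
  set K := ⌈K0⌉₊ with hK
  have hTT : T0 ≤ T := Nat.le_ceil _
  have hT2 : (T : ℝ≥0) ≤ 2 * T0 := by
    refine (Nat.ceil_lt_add_one zero_le).le.trans ?_
    rw [two_mul]
    gcongr
    exact hΛ1.trans hT0Λ
  have hK2 : (K : ℝ≥0) ≤ 2 * K0 := by
    refine (Nat.ceil_lt_add_one zero_le).le.trans ?_
    rw [two_mul]
    gcongr
  have hT1 : 1 ≤ T := by exact_mod_cast (hΛ1.trans hT0Λ).trans hTT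
  have : Nonempty (Fin (n ^ k)) := ⟨⟨0, hM1⟩⟩
  have : Nonempty (Fin (T * s)) := ⟨⟨0, Nat.mul_pos hT1 hs⟩⟩
  obtain ⟨mΩ, P, hP, hE⟩ := exists_uniform (Coins k n s T (n ^ k) (T * s))
  refine ⟨Coins k n s T (n ^ k) (T * s), mΩ, P, hP,
    protocol f g ε (NNReal.sqrt θ) Λ K enc, fun W ω => ?_, fun W => ?_⟩
  · have h1 : ((protocol f g ε (NNReal.sqrt θ) Λ K enc).cost ω W : ℝ≥0)
        ≤ c * Γ * L * (608 * Λ * θ'' ^ 2 + 6 * θ'' ^ 3) := by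
      calc ((protocol f g ε (NNReal.sqrt θ) Λ K enc).cost ω W : ℝ≥0)
          ≤ (s * (3 + 8 * T + 3 * K) : ℕ) :=
            Nat.cast_le.2 (cost_protocol_le f g ε (NNReal.sqrt θ) Λ K enc W ω)
        _ = s * (3 * 1 + 8 * T + 3 * K) := by push_cast; ring
        _ ≤ s * (3 * T0 + 8 * (2 * T0) + 3 * (2 * K0)) := by
            gcongr
            exact hΛ1.trans hT0Λ
        _ = s * 19 * T0 + 6 * s * K0 := by ring
        _ = (c / s * s) * Γ * L * (608 * Λ * θ'' ^ 2) + 6 * s * (θ'' ^ 3 * Γ * L) := by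
            rw [hT0, hK0]; ring
        -- By s ≤ c_f[s], the words about the candidates are charged to the first summand of the
        -- budget too.
        _ ≤ c * Γ * L * (608 * Λ * θ'' ^ 2) + 6 * c * (θ'' ^ 3 * Γ * L) := by
            rw [div_mul_cancel₀ _ hs0.ne']
            gcongr
        _ = _ := by ring
    have h2 : ((protocol f g ε (NNReal.sqrt θ) Λ K enc).cost ω W : ℝ)
        ≤ c * Γ * L * (608 * Λ * θ'' ^ 2 + 6 * θ'' ^ 3) := by exact_mod_cast h1
    refine h2.trans ?_
    exact cost_le_budget hs hk hn hf.one_lt h4 hε hr hΛ hLε (NNReal.coe_nonneg c)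
      (NNReal.coe_nonneg Γ) hC
  · set p := protocol f g ε (NNReal.sqrt θ) Λ K enc (T := T) (M := n ^ k) (M' := T * s)
    have h := hE fun ω => |p.output ω W - (correlation f g W : ℝ)| ≤ ε * (correlation f g W : ℝ)
    refine ⟨_, h.1, h.2 ?_, fun ω hω => hω⟩
    have hpr := pr_abs_outVal_sub_le (T := T) (M' := T * s) hf enc hs hM1 hcard hN hND hε hε1 hΛ1
      (hT0Λ.trans hTT) hTT le_rfl hLε.le (K := K) (Nat.le_ceil _)
      (exp_bound hM1' hs' (by exact_mod_cast hcard) rfl hΛ)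
      fun j => aggregate g (W j)
    simp only [p, output_protocol]
    exact hpr

end FiniteProb

end

theorem mainTheorem6 :
    ∃ C : ℝ, 0 < C ∧
      ∀ (s k n : ℕ), 1 ≤ s → 1 ≤ k → 2 ≤ n →
      ∀ (f : ℝ≥0 → ℝ≥0) (θ θ' θ'' : ℝ≥0), ApproxInvertible f θ θ' θ'' →
      ∀ (g : (Fin k → ℝ≥0) → ℝ≥0) (ε : ℝ), 0 < ε → ε < 1 →
      ∃ (Ω : Type) (_ : MeasurableSpace Ω) (P : Measure Ω) (_ : IsProbabilityMeasure P)
        (p : TwoRoundProtocol (Finset (Fin n → ℝ≥0)) (fun W => Set.range (aggregate (k := k) g W))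
          s (k * Nat.clog 2 n) Ω),
        (∀ (W : Fin s → Finset (Fin n → ℝ≥0)) (ω : Ω),
          (p.cost ω W : ℝ) ≤
            C * ((cParam f s : ℝ) / ε ^ 2 *
                  ((cParam f (bucketsA C s θ θ'' * bucketsB C s θ θ'') : ℝ) *
                    ((bucketsA C s θ θ'' : ℝ) * (bucketsB C s θ θ'' : ℝ)) *
                    Real.sqrt (θ : ℝ) * (θ'' : ℝ) ^ 3 * (k : ℝ) ^ 4 * Real.log n ^ 4)
                + (s : ℝ) / ε ^ 2 * ((k : ℝ) ^ 2 * Real.log n ^ 2 * (θ'' : ℝ) ^ 4))) ∧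
        (∀ W : Fin s → Finset (Fin n → ℝ≥0),
          ∃ E : Set Ω, MeasurableSet E ∧ 9 / 10 ≤ P E ∧
            ∀ ω ∈ E, (1 - ε) * (correlation f g W : ℝ) ≤ p.output ω W ∧
              p.output ω W ≤ (1 + ε) * (correlation f g W : ℝ)) := by
  refine ⟨10 ^ 18, by norm_num, fun s k n hs hk hn f θ θ' θ'' hf g ε hε hε1 => ?_⟩
  by_cases hf0 : ∃ y, f y ≠ 0
  · obtain ⟨y, hy⟩ := hf0
    lift ε to ℝ≥0 using hε.le
    obtain ⟨Ω, mΩ, P, hP, p, hcost, hout⟩ := FiniteProb.exists_protocol hs hk hn hf hy g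
      (ε := ε) (by exact_mod_cast hε) (by exact_mod_cast hε1) (le_refl (10 ^ 18 : ℝ))
    refine ⟨Ω, mΩ, P, hP, p, fun W ω => (hcost W ω).trans ?_, fun W => ?_⟩
    · have : (0 : ℝ) ≤ s / ε ^ 2 * (k ^ 2 * Real.log n ^ 2 * θ'' ^ 4) := by positivity
      linarith
    · obtain ⟨E, hE, hPE, h⟩ := hout W
      refine ⟨E, hE, hPE, fun ω hω => ?_⟩
      have := abs_le.1 (h ω hω)
      constructor <;> linarith
  -- For f = 0 the bounds 4θ ≤ θ'' and s ≤ c_f[s] are not available, but the correlation is 0 and no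
  -- communication is needed.
  · push Not at hf0
    refine ⟨Unit, ⊤, Measure.dirac (), inferInstance, FiniteProb.silentProtocol _ _ s _,
      fun W ω => ?_, fun W => ⟨Set.univ, MeasurableSet.univ, ?_, fun ω _ => ?_⟩⟩
    · have : (FiniteProb.silentProtocol (Finset (Fin n → ℝ≥0))
          (fun W => Set.range (aggregate (k := k) g W)) s (k * Nat.clog 2 n)).cost ω W = 0 :=
        Finset.sum_eq_zero fun j _ => rfl
      rw [this]
      push_cast
      positivity
    · rw [measure_univ, ENNReal.div_le_iff (by norm_num) (by norm_num)]
      norm_num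
    · have : correlation f g W = 0 := Finset.sum_eq_zero fun i _ => hf0 _
      rw [this]
      simp only [NNReal.coe_zero, mul_zero]
      exact ⟨le_rfl, le_rfl⟩
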